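/- Let $N\ge 1$, $1\le p<1+\frac2N$, and let $\mathbb T^N=\mathbb R^N/\mathbb Z^N$ be the torus of volume one, with Lebesgue measure. Write $\hat f(\mathbf k)=\int_{\mathbb T^N}f(x)e^{-2\pi i\mathbf k\cdot x}\,dx$ and $\|f\|_{H^s}^2=\sum_{\mathbf k\in\mathbb Z^N}(1+|\mathbf k|^2)^s|\hat f(\mathbf k)|^2$, and let $e^{t\Delta}$ be the heat semigroup, $\widehat{e^{t\Delta}f}(\mathbf k)=e^{-4\pi^2|\mathbf k|^2t}\hat f(\mathbf k)$. Let $v\in L^\infty(\mathbb R_+;L^\infty(\mathbb T^N;\mathbb R^N))$ with $\operatorname{div}v(t)=0$ in the sense of distributions for a.e. $t>0$, and let $u_0\in L^2(\mathbb T^N)$ be real with $\int_{\mathbb T^N}u_0\,dx=0$. Consider $$u_t+v\cdot\nabla u-\Delta u=|u|^p-\int_{\mathbb T^N}|u|^p\,dx\ \text{ on }\mathbb T^N,\qquad u(0)=u_0.\qquad(1)$$ For $T>0$ let $X_T$ be the space of real $u\in C([0,T];L^2(\mathbb T^N))$ with $\sup_{0<t\le T}t^{1/2}\|\nabla u(t)\|_{L^2}<\infty$.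 A function $u\in C([0,T];L^2)$ with $\nabla u(t)\in L^2$ for $0<t\le T$ is a mild solution of (1) on $[0,T]$ if for all $t\in[0,T]$ $$u(t)=e^{t\Delta}u_0+\int_0^te^{(t-\tau)\Delta}(|u|^p)\,d\tau-\int_0^te^{(t-\tau)\Delta}(v\cdot\nabla u)\,d\tau-\int_0^t\int_{\mathbb T^N}|u|^p\,dx\,d\tau$$ in $L^2(\mathbb T^N)$, the integrals being (existing) Bochner integrals. Let $T>0$ and let $u\in X_T$ be a mild solution of (1) on $[0,T]$. Then $u$ is a weak solution of (1) on $[0,T)$: $u\in L^\infty([0,T];L^2)\cap L^2([0,T];H^1)$, $\partial_tu\in L^2([0,T];H^{-1})$, the functions $|u|^p$ and $v\cdot\nabla u$ are integrable over $[0,T]\times\mathbb T^N$, and for all $\varphi\in C_c^\infty([0,T)\times\mathbb T^N)$ $$\int_{\mathbb T^N}u_0\varphi(0)\,dx+\int_0^T\!\!\int_{\mathbb T^N}u\,\partial_t\varphi\,dx\,dt=\int_0^T\!\!\int_{\mathbb T^N}\varphi\,(v\cdot\nabla u)\,dx\,dt-\int_0^T\!\!\int_{\mathbb T^N}|u|^p\varphi\,dx\,dt$$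 $$\qquad+\int_0^T\!\!\int_{\mathbb T^N}\nabla u\cdot\nabla\varphi\,dx\,dt+\int_0^T\Big(\int_{\mathbb T^N}|u|^p\,dx\Big)\Big(\int_{\mathbb T^N}\varphi\,dx\Big)dt.$$ Moreover, for every $0\le t<T$ the functions $|u|^pu$ and $|\nabla u|^2$ are integrable over $[0,t]\times\mathbb T^N$, and the energy identity holds: $$\|u_0\|_{L^2}^2+2\int_0^t\!\!\int_{\mathbb T^N}|u|^pu\,dx\,d\tau=\|u(t)\|_{L^2}^2+2\int_0^t\!\!\int_{\mathbb T^N}|\nabla u|^2\,dx\,d\tau.$$ -/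

import Mathlib

open MeasureTheory Set
open scoped ENNReal ContDiff

noncomputable section

namespace TorusPDE

/-- The torus `𝕋ᴺ = ℝᴺ / ℤᴺ`. -/
abbrev Torus (N : ℕ) : Type := UnitAddTorus (Fin N)

/-- Lebesgue measure on `𝕋ᴺ = [0,1]ᴺ`, of total mass one. -/
abbrev torusMeasure (N : ℕ) : Measure (Torus N) :=
  Measure.pi fun _ : Fin N => (AddCircle.haarAddCircle : Measure UnitAddCircle)

/-- The real Hilbert space `L²(𝕋ᴺ)`. -/
abbrev L2 (N : ℕ) : Type := Lp ℝ 2 (torusMeasure N)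

/-- The real Hilbert space `L²(𝕋ᴺ; ℝᴺ)`. -/
abbrev VecL2 (N : ℕ) : Type := Lp (EuclideanSpace ℝ (Fin N)) 2 (torusMeasure N)

/-- The quotient map `ℝᴺ → 𝕋ᴺ`. -/
def toTorus {N : ℕ} (y : Fin N → ℝ) : Torus N := fun i => ((y i : ℝ) : UnitAddCircle)

/-- `ψ ∈ C^∞(𝕋ᴺ)`: the periodic lift of `ψ` to `ℝᴺ` is smooth. -/
def IsSmooth {N : ℕ} (ψ : Torus N → ℝ) : Prop :=
  ContDiff ℝ ∞ fun y : Fin N → ℝ => ψ (toTorus y)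

/-- The classical gradient of a function on the torus. -/
def grad {N : ℕ} (ψ : Torus N → ℝ) (x : Torus N) : EuclideanSpace ℝ (Fin N) :=
  WithLp.toLp 2 fun i => deriv (fun s : ℝ => ψ (x + Pi.single i (s : UnitAddCircle))) 0

/-- `G` is the weak gradient of `f` on the torus. -/
def IsWeakGrad {N : ℕ} (f : Torus N → ℝ) (G : Torus N → EuclideanSpace ℝ (Fin N)) : Prop :=
  ∀ ψ : Torus N → ℝ, IsSmooth ψ → ∀ i : Fin N,
    ∫ x, f x * grad ψ x i ∂torusMeasure N = -∫ x, G x i * ψ x ∂torusMeasure N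

/-- `∇f ∈ L²(𝕋ᴺ)`. -/
def HasL2Grad {N : ℕ} (f : L2 N) : Prop := ∃ G : VecL2 N, IsWeakGrad f G

open Classical in
/-- The weak gradient `∇f ∈ L²(𝕋ᴺ; ℝᴺ)` of `f ∈ L²(𝕋ᴺ)` (zero if `∇f ∉ L²`). -/
def weakGrad {N : ℕ} (f : L2 N) : VecL2 N := if h : HasL2Grad f then h.choose else 0

theorem weakGrad_spec {N : ℕ} {f : L2 N} (h : HasL2Grad f) : IsWeakGrad f (weakGrad f) := by
  rw [weakGrad, dif_pos h]
  exact h.choose_spec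

/-- `|k|²` for a frequency `k ∈ ℤᴺ`. -/
def freqSq {N : ℕ} (k : Fin N → ℤ) : ℝ := ∑ i, (k i : ℝ) ^ 2

/-- The Fourier coefficients `∫ f(x) e^{-2πi k·x} dx`, `k ∈ ℤᴺ`, of a real function. -/
def torusCoeff {N : ℕ} (f : Torus N → ℝ) (k : Fin N → ℤ) : ℂ :=
  UnitAddTorus.mFourierCoeff (fun x => (f x : ℂ)) k

/-- `‖·‖²_{H^s}` of the periodic distribution with Fourier coefficients `c`; the distribution
belongs to `H^s(𝕋ᴺ)` exactly if this is finite. -/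
def sobolevNormSq {N : ℕ} (s : ℝ) (c : (Fin N → ℤ) → ℂ) : ℝ≥0∞ :=
  ∑' k, ENNReal.ofReal ((1 + freqSq k) ^ s) * ‖c k‖ₑ ^ 2

/-- The heat semigroup `e^{tΔ}f`, the element of `L²` with Fourier coefficients
`e^{-4π²|k|²t} f̂(k)`. The sum below converges in `L²` if and only if these coefficients are square
summable; for real `f` it is real, and `reCLM` only moves it to the real `L²`. -/
def heat {N : ℕ} (t : ℝ) (f : Torus N → ℝ) : L2 N :=
  Complex.reCLM.compLp
    (∑' k : Fin N → ℤ,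
      ((Real.exp (-(4 * Real.pi ^ 2 * freqSq k) * t) : ℂ) * torusCoeff f k) •
        ContinuousMap.toLp (E := ℂ) 2 (torusMeasure N) ℂ (UnitAddTorus.mFourier k))

/-- The function `|f|^p`. -/
def absPow {N : ℕ} (p : ℝ) (f : L2 N) : Torus N → ℝ := fun x => |f x| ^ p

/-- The function `w · ∇f`. -/
def advect {N : ℕ} (w : Torus N → EuclideanSpace ℝ (Fin N)) (f : L2 N) : Torus N → ℝ :=
  fun x => inner ℝ (w x) (weakGrad f x)

/-- `div w = 0` in the sense of distributions. -/
def IsDivFree {N : ℕ} (w : Torus N → EuclideanSpace ℝ (Fin N)) : Prop :=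
  ∀ ψ : Torus N → ℝ, IsSmooth ψ → ∫ x, inner ℝ (w x) (grad ψ x) ∂torusMeasure N = 0

/-- `v ∈ L^∞(ℝ₊; L^∞(𝕋ᴺ; ℝᴺ))`. -/
def IsBoundedFlow {N : ℕ} (v : ℝ → Torus N → EuclideanSpace ℝ (Fin N)) : Prop :=
  MemLp (Function.uncurry v) ⊤ ((volume.restrict (Ioi (0 : ℝ))).prod (torusMeasure N))

/-- `v(t)` is divergence free for almost every `t > 0`. -/
def IsIncompressible {N : ℕ} (v : ℝ → Torus N → EuclideanSpace ℝ (Fin N)) : Prop :=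
  ∀ᵐ t ∂volume.restrict (Ioi (0 : ℝ)), IsDivFree (v t)

/-- `u ∈ X_T`: `u ∈ C([0,T]; L²)` and `sup_{0 < t ≤ T} t^{1/2} ‖∇u(t)‖_{L²} < ∞`. -/
def MemX {N : ℕ} (T : ℝ) (u : ℝ → L2 N) : Prop :=
  ContinuousOn u (Icc 0 T) ∧
    ∃ M : ℝ, ∀ t ∈ Ioc 0 T, HasL2Grad (u t) ∧ √t * ‖weakGrad (u t)‖ ≤ M

/-- Mild solutions on `[0,T]` of `u_t + v·∇u - Δu = |u|^p - ∫ |u|^p`, `u(0) = u₀`: the Bochner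
integrals in Duhamel's formula exist, and the formula holds in `L²` for all `t ∈ [0,T]`. -/
def IsMildSolution {N : ℕ} (p : ℝ) (v : ℝ → Torus N → EuclideanSpace ℝ (Fin N))
    (u₀ : L2 N) (T : ℝ) (u : ℝ → L2 N) : Prop :=
  ContinuousOn u (Icc 0 T) ∧ (∀ t ∈ Ioc 0 T, HasL2Grad (u t)) ∧
  ∀ t ∈ Icc 0 T,
    IntervalIntegrable (fun τ => heat (t - τ) (absPow p (u τ))) volume 0 t ∧
    IntervalIntegrable (fun τ => heat (t - τ) (advect (v τ) (u τ))) volume 0 t ∧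
    IntervalIntegrable (fun τ => ∫ x, absPow p (u τ) x ∂torusMeasure N) volume 0 t ∧
    u t = heat t u₀ + (∫ τ in 0..t, heat (t - τ) (absPow p (u τ)))
      - (∫ τ in 0..t, heat (t - τ) (advect (v τ) (u τ)))
      - Lp.const 2 (torusMeasure N) (∫ τ in 0..t, ∫ x, absPow p (u τ) x ∂torusMeasure N)

/-- `φ ∈ C_c^∞([0,T) × 𝕋ᴺ)`. Test functions are taken as restrictions of smooth functions on
`ℝ × 𝕋ᴺ`; their values at negative times play no role. -/
def IsTestFunction {N : ℕ} (T : ℝ) (φ : ℝ → Torus N → ℝ) : Prop :=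
  ContDiff ℝ ∞ (fun z : ℝ × (Fin N → ℝ) => φ z.1 (toTorus z.2)) ∧
    ∃ T' < T, ∀ t ≥ T', ∀ x, φ t x = 0

/-- `∂_t u ∈ L²([0,T]; H^{-1})`: some `g ∈ L²([0,T]; H^{-1})`, given by the Fourier coefficients
`g t k` of `g t`, satisfies `∫ ψ' u dt = -∫ ψ g dt` in `H^{-1}`, that is for each Fourier
coefficient, for all `ψ ∈ C_c^∞((0,T))`. -/
def HasTimeDerivL2HNegOne {N : ℕ} (T : ℝ) (u : ℝ → L2 N) : Prop :=
  ∃ g : ℝ → (Fin N → ℤ) → ℂ,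
    (∀ k, AEStronglyMeasurable (fun t => g t k) (volume.restrict (Icc 0 T))) ∧
    ∫⁻ t in Icc 0 T, sobolevNormSq (-1) (g t) < ⊤ ∧
    ∀ ψ : ℝ → ℝ, ContDiff ℝ ∞ ψ → tsupport ψ ⊆ Ioo 0 T → ∀ k,
      ∫ t in 0..T, ((deriv ψ t : ℝ) : ℂ) * torusCoeff (u t) k = -∫ t in 0..T, (ψ t : ℂ) * g t k

/-- Weak solutions on `[0,T)` of `u_t + v·∇u - Δu = |u|^p - ∫ |u|^p`, `u(0) = u₀`:
`u ∈ L^∞([0,T]; L²) ∩ L²([0,T]; H¹)`, `∂_t u ∈ L²([0,T]; H^{-1})`, the nonlinear and the advection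
term are integrable on `[0,T] × 𝕋ᴺ` (so that every integral in the weak formulation converges),
and the weak formulation holds for all test functions. -/
def IsWeakSolution {N : ℕ} (p : ℝ) (v : ℝ → Torus N → EuclideanSpace ℝ (Fin N))
    (u₀ : L2 N) (T : ℝ) (u : ℝ → L2 N) : Prop :=
  MemLp u ⊤ (volume.restrict (Icc 0 T)) ∧
  ∫⁻ t in Icc 0 T, sobolevNormSq 1 (torusCoeff (u t)) < ⊤ ∧
  HasTimeDerivL2HNegOne T u ∧
  (∀ᵐ t ∂volume.restrict (Icc 0 T), Integrable (absPow p (u t)) (torusMeasure N) ∧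
    Integrable (advect (v t) (u t)) (torusMeasure N)) ∧
  IntervalIntegrable (fun t => ∫ x, absPow p (u t) x ∂torusMeasure N) volume 0 T ∧
  IntervalIntegrable (fun t => ∫ x, |advect (v t) (u t) x| ∂torusMeasure N) volume 0 T ∧
  ∀ φ : ℝ → Torus N → ℝ, IsTestFunction T φ →
    (∫ x, u₀ x * φ 0 x ∂torusMeasure N)
      + (∫ t in 0..T, ∫ x, u t x * deriv (fun s => φ s x) t ∂torusMeasure N) =
    (∫ t in 0..T, ∫ x, φ t x * advect (v t) (u t) x ∂torusMeasure N)
      - (∫ t in 0..T, ∫ x, absPow p (u t) x * φ t x ∂torusMeasure N)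
      + (∫ t in 0..T, ∫ x, inner ℝ (weakGrad (u t) x) (grad (φ t) x) ∂torusMeasure N)
      + (∫ t in 0..T, (∫ x, absPow p (u t) x ∂torusMeasure N) * (∫ x, φ t x ∂torusMeasure N))

end TorusPDE

end

open TorusPDE

noncomputable section

namespace TorusPDE

open UnitAddTorus Filter Topology
open scoped ComplexConjugate

variable {N : ℕ}

/-! Everything is done one Fourier mode at a time. Applying the coefficient functional to Duhamel's
formula gives, for each `k`, a scalar identity with kernel `e^{-λ(t-τ)}`, `λ = 4π²|k|²`, and hence
the integrated equation `û' = -λ û + F̂`, where `F = |u|^p - v·∇u - ∫ |u|^p`. The weak formulation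
and the energy identity are the product rule for these scalar functions, summed over `k` by Parseval
(`IsHeatFlow.integral_mul_sub`). The summation is legitimate once `F` and `∇u` lie in `L²((0,T) ×
𝕋ᴺ)`.

The bound `√t ‖∇u(t)‖ ≤ M` alone does not give `∇u ∈ L²` near `t = 0`, since `1/t` is not
integrable. The remedy is a growth estimate `‖F‖² ≤ C (1 + ‖∇u‖²)` in `L²(𝕋ᴺ)`, with `C` depending
on the supremum of `‖u(t)‖` and on the bound for `v`. On `[s,T]` with `s > 0` the energy identity
holds, and Young's inequality absorbs the term `2∫∫Fu` into half of the dissipation. This bounds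
`∫_s^T ‖∇u‖²` independently of `s`, and `s → 0` gives integrability
(`IsHeatFlow.integrableOn_sq_norm_grad`).

The growth estimate is immediate for `v·∇u`. For `|u|^p` it is a Gagliardo–Nirenberg inequality for
`‖u‖_{2p}^{2p}`, linear in `‖∇u‖²`, which is where `2p < 2 + 4/N` is needed
(`exists_memLp_absRpow`). It follows from a weak-type bound: at each height the function is split
into low frequencies, bounded pointwise by Cauchy–Schwarz, and high frequencies, small in `L²`.

In the energy identity `∫ u v·∇u = 0` by incompressibility, and the mean term is multiplied by `∫
u`, which stays zero because `F` has mean zero. -/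

/-! ### Fourier coefficients, Parseval's identity and the heat semigroup -/

theorem mFourierCoeff_eq (f : Torus N → ℂ) (k : Fin N → ℤ) :
    mFourierCoeff f k = ∫ x, mFourier (-k) x * f x ∂torusMeasure N := rfl

theorem torusCoeff_eq (f : Torus N → ℝ) (k : Fin N → ℤ) :
    torusCoeff f k = ∫ x, mFourier (-k) x * (f x : ℂ) ∂torusMeasure N := rfl

theorem mFourierCoeff_congr_ae {f g : Torus N → ℂ} (h : f =ᵐ[torusMeasure N] g)
    (k : Fin N → ℤ) : mFourierCoeff f k = mFourierCoeff g k := by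
  simp only [mFourierCoeff_eq]
  exact integral_congr_ae (h.mono fun x hx => by simp [hx])

theorem torusCoeff_congr_ae {f g : Torus N → ℝ} (h : f =ᵐ[torusMeasure N] g)
    (k : Fin N → ℤ) : torusCoeff f k = torusCoeff g k :=
  mFourierCoeff_congr_ae (h.mono fun x hx => by simp [hx]) k

theorem mFourierCoeff_conj (f : Torus N → ℂ) (k : Fin N → ℤ) :
    mFourierCoeff (fun x => conj (f x)) k = conj (mFourierCoeff f (-k)) := by
  rw [mFourierCoeff_eq, mFourierCoeff_eq, ← integral_conj]
  simp [mFourier_neg]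

theorem torusCoeff_neg (f : Torus N → ℝ) (k : Fin N → ℤ) :
    torusCoeff f (-k) = conj (torusCoeff f k) := by
  have h := mFourierCoeff_conj (fun x => (f x : ℂ)) (-k)
  simp only [Complex.conj_ofReal, neg_neg] at h
  exact h

theorem norm_mFourier_apply (k : Fin N → ℤ) (x : Torus N) : ‖mFourier k x‖ = 1 := by
  simp [mFourier, norm_prod, Circle.norm_coe]

/-- Parseval's identity in bilinear form. -/
theorem hasSum_mFourierCoeff_mul {f g : Torus N → ℂ} (hf : MemLp f 2 (torusMeasure N))
    (hg : MemLp g 2 (torusMeasure N)) :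
    HasSum (fun k => mFourierCoeff f k * mFourierCoeff g (-k)) (∫ x, f x * g x ∂torusMeasure N) := by
  -- Conjugating `f` turns the Hermitian pairing into the bilinear integral; the reindexing `k ↦ -k`
  -- then removes all conjugates.
  have hf' : MemLp (fun x => conj (f x)) 2 (torusMeasure N) := hf.star
  have h := hasSum_prod_mFourierCoeff hf'.toLp hg.toLp
  rw [← (Equiv.neg (Fin N → ℤ)).hasSum_iff] at h
  convert h using 1
  · funext k
    simp only [Function.comp_apply, Equiv.neg_apply]
    rw [mFourierCoeff_congr_ae hf'.coeFn_toLp, mFourierCoeff_congr_ae hg.coeFn_toLp,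
      mFourierCoeff_conj]
    simp
  · refine integral_congr_ae ?_
    filter_upwards [hf'.coeFn_toLp, hg.coeFn_toLp] with x h1 h2
    rw [h1, h2]; simp

/-- Parseval's identity for square integrable complex functions. -/
theorem hasSum_sq_norm_mFourierCoeff {f : Torus N → ℂ} (hf : MemLp f 2 (torusMeasure N)) :
    HasSum (fun k => ‖mFourierCoeff f k‖ ^ 2) (∫ x, ‖f x‖ ^ 2 ∂torusMeasure N) := by
  convert hasSum_sq_mFourierCoeff hf.toLp using 1
  · funext k
    rw [mFourierCoeff_congr_ae hf.coeFn_toLp]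
  · refine integral_congr_ae ?_
    filter_upwards [hf.coeFn_toLp] with x h1
    rw [h1]

/-- Parseval's identity for real functions. -/
theorem hasSum_torusCoeff_mul {f g : Torus N → ℝ} (hf : MemLp f 2 (torusMeasure N))
    (hg : MemLp g 2 (torusMeasure N)) :
    HasSum (fun k => torusCoeff f k * conj (torusCoeff g k))
      ((∫ x, f x * g x ∂torusMeasure N : ℝ) : ℂ) := by
  convert hasSum_mFourierCoeff_mul hf.ofReal hg.ofReal using 1
  · funext k
    rw [← torusCoeff_neg]; rfl
  · rw [← integral_complex_ofReal]; simp

theorem hasSum_sq_norm_torusCoeff {f : Torus N → ℝ} (hf : MemLp f 2 (torusMeasure N)) :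
    HasSum (fun k => ‖torusCoeff f k‖ ^ 2) (∫ x, f x ^ 2 ∂torusMeasure N) := by
  have h := hasSum_sq_norm_mFourierCoeff (f := fun x => (f x : ℂ)) hf.ofReal
  simp only [Complex.norm_real, Real.norm_eq_abs, sq_abs] at h
  exact h

theorem sq_norm_torusCoeff_le {f : Torus N → ℝ} (hf : MemLp f 2 (torusMeasure N))
    (k : Fin N → ℤ) : ‖torusCoeff f k‖ ^ 2 ≤ ∫ x, f x ^ 2 ∂torusMeasure N :=
  le_hasSum (hasSum_sq_norm_torusCoeff hf) k fun _ _ => by positivity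

theorem integrable_mFourier_mul {f : Torus N → ℂ} (hf : Integrable f (torusMeasure N))
    (k : Fin N → ℤ) : Integrable (fun x => mFourier k x * f x) (torusMeasure N) := by
  refine hf.bdd_mul (c := 1) (mFourier k).continuous.aestronglyMeasurable ?_
  exact Eventually.of_forall fun x => (norm_mFourier_apply k x).le

theorem mFourierCoeff_add {f g : Torus N → ℂ} (hf : Integrable f (torusMeasure N))
    (hg : Integrable g (torusMeasure N)) (k : Fin N → ℤ) :
    mFourierCoeff (fun x => f x + g x) k = mFourierCoeff f k + mFourierCoeff g k := by
  simp only [mFourierCoeff_eq, mul_add]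
  exact integral_add (integrable_mFourier_mul hf _) (integrable_mFourier_mul hg _)

theorem mFourierCoeff_sub {f g : Torus N → ℂ} (hf : Integrable f (torusMeasure N))
    (hg : Integrable g (torusMeasure N)) (k : Fin N → ℤ) :
    mFourierCoeff (fun x => f x - g x) k = mFourierCoeff f k - mFourierCoeff g k := by
  simp only [mFourierCoeff_eq, mul_sub]
  exact integral_sub (integrable_mFourier_mul hf _) (integrable_mFourier_mul hg _)

theorem mFourierCoeff_const_mul (c : ℂ) (f : Torus N → ℂ) (k : Fin N → ℤ) :
    mFourierCoeff (fun x => c * f x) k = c * mFourierCoeff f k := by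
  simp only [mFourierCoeff_eq]
  rw [← integral_const_mul]
  congr 1; funext x; ring

theorem torusCoeff_add {f g : Torus N → ℝ} (hf : Integrable f (torusMeasure N))
    (hg : Integrable g (torusMeasure N)) (k : Fin N → ℤ) :
    torusCoeff (fun x => f x + g x) k = torusCoeff f k + torusCoeff g k := by
  have h := mFourierCoeff_add (f := fun x => (f x : ℂ)) (g := fun x => (g x : ℂ))
    hf.ofReal hg.ofReal k
  simp only [← Complex.ofReal_add] at h
  exact h

theorem torusCoeff_sub {f g : Torus N → ℝ} (hf : Integrable f (torusMeasure N))
    (hg : Integrable g (torusMeasure N)) (k : Fin N → ℤ) :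
    torusCoeff (fun x => f x - g x) k = torusCoeff f k - torusCoeff g k := by
  have h := mFourierCoeff_sub (f := fun x => (f x : ℂ)) (g := fun x => (g x : ℂ))
    hf.ofReal hg.ofReal k
  simp only [← Complex.ofReal_sub] at h
  exact h

theorem torusCoeff_const_mul (c : ℝ) (f : Torus N → ℝ) (k : Fin N → ℤ) :
    torusCoeff (fun x => c * f x) k = c * torusCoeff f k := by
  have h := mFourierCoeff_const_mul c (fun x => (f x : ℂ)) k
  simp only [← Complex.ofReal_mul] at h
  exact h

theorem torusCoeff_zero (f : Torus N → ℝ) :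
    torusCoeff f 0 = ((∫ x, f x ∂torusMeasure N : ℝ) : ℂ) := by
  rw [torusCoeff_eq, ← integral_complex_ofReal]
  simp [mFourier_zero]

theorem mFourierCoeff_mFourier (k l : Fin N → ℤ) :
    mFourierCoeff (mFourier l : Torus N → ℂ) k = if k = l then 1 else 0 := by
  have h := (orthonormal_iff_ite.1 (orthonormal_mFourier (d := Fin N))) k l
  rw [ContinuousMap.inner_toLp] at h
  rw [← h, mFourierCoeff_eq]
  refine integral_congr_ae (Eventually.of_forall fun x => ?_)
  simp [mFourier_neg, mul_comm]

theorem torusCoeff_const (c : ℝ) (k : Fin N → ℤ) :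
    torusCoeff (fun _ : Torus N => c) k = if k = 0 then (c : ℂ) else 0 := by
  have h := mFourierCoeff_mFourier k (0 : Fin N → ℤ)
  rw [mFourier_zero, mFourierCoeff_eq] at h
  have h2 : torusCoeff (fun _ : Torus N => c) k
      = (∫ x, mFourier (-k) x * (1 : C(Torus N, ℂ)) x ∂torusMeasure N) * c := by
    rw [torusCoeff_eq, ← integral_mul_const]
    simp
  rw [h2, h]
  split_ifs <;> simp

theorem memLp_coe (f : L2 N) : MemLp f 2 (torusMeasure N) := Lp.memLp f

theorem integral_sq_eq_norm_sq (f : L2 N) : ∫ x, f x ^ 2 ∂torusMeasure N = ‖f‖ ^ 2 := by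
  rw [← real_inner_self_eq_norm_sq, L2.inner_def]
  simp [pow_two]

theorem norm_torusCoeff_le (f : L2 N) (k : Fin N → ℤ) : ‖torusCoeff f k‖ ≤ ‖f‖ := by
  have h := sq_norm_torusCoeff_le (memLp_coe f) k
  rw [integral_sq_eq_norm_sq] at h
  exact le_of_sq_le_sq h (norm_nonneg _)

/-- The Fourier coefficient at frequency `k` as a continuous linear functional on `L²`. -/
def coeffCLM (k : Fin N → ℤ) : L2 N →L[ℝ] ℂ :=
  LinearMap.mkContinuous
    { toFun := fun f => torusCoeff f k
      map_add' := fun f g => by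
        rw [torusCoeff_congr_ae (Lp.coeFn_add f g)]
        exact torusCoeff_add ((memLp_coe f).integrable (by norm_num))
          ((memLp_coe g).integrable (by norm_num)) k
      map_smul' := fun c f => by
        rw [torusCoeff_congr_ae (Lp.coeFn_smul c f)]
        exact torusCoeff_const_mul c f k }
    1 (fun f => by simpa using norm_torusCoeff_le f k)

@[simp]
theorem coeffCLM_apply (k : Fin N → ℤ) (f : L2 N) : coeffCLM k f = torusCoeff f k := rfl

theorem freqSq_nonneg (k : Fin N → ℤ) : 0 ≤ freqSq k :=
  Finset.sum_nonneg fun _ _ => sq_nonneg _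

theorem freqSq_neg (k : Fin N → ℤ) : freqSq (-k) = freqSq k := by simp [freqSq]

/-- The eigenvalue `4π²|k|²` of `-Δ`. -/
def eig (k : Fin N → ℤ) : ℝ := 4 * Real.pi ^ 2 * freqSq k

theorem eig_nonneg (k : Fin N → ℤ) : 0 ≤ eig k :=
  mul_nonneg (by positivity) (freqSq_nonneg k)

/-- Square summability makes the series the inverse image of `a` under the Hilbert basis isometry,
so the `tsum` takes its genuine value and its coefficients can be read off. -/
theorem mFourierCoeff_tsum {a : (Fin N → ℤ) → ℂ} (ha : Summable fun k => ‖a k‖ ^ 2)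
    (k : Fin N → ℤ) :
    mFourierCoeff (∑' k : Fin N → ℤ, a k •
        ContinuousMap.toLp (E := ℂ) 2 (torusMeasure N) ℂ (mFourier k) :
          Lp ℂ 2 (torusMeasure N)) k = a k := by
  have hmem : Memℓp a 2 := by
    rw [memℓp_gen_iff (by norm_num)]
    simpa using ha
  have hs := (mFourierBasis (d := Fin N)).hasSum_repr_symm ⟨a, hmem⟩
  have h := hs.tsum_eq
  rw [coe_mFourierBasis] at h
  have h2 := mFourierBasis_repr ((mFourierBasis (d := Fin N)).repr.symm ⟨a, hmem⟩) k
  rw [LinearIsometryEquiv.apply_symm_apply] at h2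
  rw [← h] at h2
  exact h2.symm

theorem torusCoeff_heat {f : Torus N → ℝ} (hf : MemLp f 2 (torusMeasure N)) {t : ℝ} (ht : 0 ≤ t)
    (k : Fin N → ℤ) :
    torusCoeff (heat t f) k = (Real.exp (-eig k * t) : ℂ) * torusCoeff f k := by
  set a : (Fin N → ℤ) → ℂ := fun k => (Real.exp (-eig k * t) : ℂ) * torusCoeff f k with ha
  have hsum : Summable fun k => ‖a k‖ ^ 2 := by
    refine Summable.of_nonneg_of_le (fun _ => by positivity) (fun k => ?_)
      (hasSum_sq_norm_torusCoeff hf).summable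
    rw [ha, norm_mul, mul_pow]
    have h1 : ‖(Real.exp (-eig k * t) : ℂ)‖ ≤ 1 := by
      rw [Complex.norm_real, Real.norm_eq_abs, Real.abs_exp, Real.exp_le_one_iff]
      nlinarith [eig_nonneg k]
    exact mul_le_of_le_one_left (by positivity) (pow_le_one₀ (norm_nonneg _) h1)
  set S : Lp ℂ 2 (torusMeasure N) := ∑' k : Fin N → ℤ, a k •
        ContinuousMap.toLp (E := ℂ) 2 (torusMeasure N) ℂ (mFourier k) with hS
  have hc : ∀ k, mFourierCoeff S k = a k := mFourierCoeff_tsum hsum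
  have hheat : heat t f = Complex.reCLM.compLp S := rfl
  have hint : Integrable S (torusMeasure N) := (Lp.memLp S).integrable (by norm_num)
  -- Hermitian symmetry of the coefficients: `Re S = (S + conj S)/2` has coefficients `(a k + conj
  -- (a (-k)))/2 = a k`, so passing to the real part in `heat` loses nothing.
  have haneg : conj (a (-k)) = a k := by
    simp only [ha, map_mul, Complex.conj_ofReal, torusCoeff_neg, Complex.conj_conj]
    rw [show eig (-k) = eig k by simp [eig, freqSq_neg]]
  rw [hheat, torusCoeff]
  have h1 : (fun x => (((Complex.reCLM.compLp S : L2 N) x : ℝ) : ℂ)) =ᵐ[torusMeasure N]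
      fun x => (1 / 2 : ℂ) * (S x + conj (S x)) := by
    filter_upwards [Complex.reCLM.coeFn_compLp S] with x hx
    rw [hx, Complex.add_conj]; simp
  rw [mFourierCoeff_congr_ae h1]
  have h2 : mFourierCoeff (fun x => (1 / 2 : ℂ) * (S x + conj (S x))) k
      = (1 / 2 : ℂ) * (mFourierCoeff S k + mFourierCoeff (fun x => conj (S x)) k) := by
    rw [mFourierCoeff_const_mul]
    congr 1
    exact mFourierCoeff_add hint ((Complex.conjLIE.integrable_comp_iff).2 hint) k
  rw [h2, mFourierCoeff_conj, hc, hc, haneg]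
  simp only [ha]; ring

/-! ### Weak gradients and divergence in Fourier variables -/

/-- Lets continuity on the torus be tested on periodic lifts, the only place where smoothness is
defined. -/
theorem isOpenQuotientMap_toTorus : IsOpenQuotientMap (toTorus : (Fin N → ℝ) → Torus N) :=
  IsOpenQuotientMap.piMap fun _ : Fin N =>
    (QuotientAddGroup.isOpenQuotientMap_mk : IsOpenQuotientMap
      (QuotientAddGroup.mk : ℝ → UnitAddCircle))

theorem toTorus_add_single (y : Fin N → ℝ) (i : Fin N) (s : ℝ) :
    toTorus y + Pi.single i (s : UnitAddCircle) = toTorus (y + s • Pi.single i 1) := by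
  funext j
  by_cases h : j = i
  · subst h; simp [toTorus]
  · simp [toTorus, h]

theorem continuous_add_single (i : Fin N) :
    Continuous fun z : ℝ × Torus N => z.2 + Pi.single i (z.1 : UnitAddCircle) := by
  have h1 : Continuous fun s : ℝ => (s : UnitAddCircle) := AddCircle.continuous_mk' _
  refine continuous_pi fun j => ?_
  simp only [Pi.add_apply]
  refine ((continuous_apply j).comp continuous_snd).add ?_
  by_cases h : j = i
  · subst h
    simpa using! h1.comp continuous_fst
  · simpa [h] using! (continuous_const : Continuous fun _ : ℝ × Torus N => (0 : UnitAddCircle))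

theorem integrable_mFourier_mul_ofReal {f : Torus N → ℝ} (hf : Integrable f (torusMeasure N))
    (k : Fin N → ℤ) : Integrable (fun x => mFourier k x * (f x : ℂ)) (torusMeasure N) :=
  integrable_mFourier_mul (f := fun x => (f x : ℂ)) hf.ofReal k

theorem mFourier_add_single (k : Fin N → ℤ) (x : Torus N) (i : Fin N) (s : ℝ) :
    mFourier k (x + Pi.single i (s : UnitAddCircle))
      = mFourier k x * Complex.exp (2 * Real.pi * Complex.I * k i * s) := by
  have h1 : mFourier k (x + Pi.single i (s : UnitAddCircle))
      = mFourier k x * mFourier k (Pi.single i (s : UnitAddCircle)) := by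
    simp only [mFourier, ContinuousMap.coe_mk, ← Finset.prod_mul_distrib]
    refine Finset.prod_congr rfl fun j _ => ?_
    simp [fourier_apply, smul_add, AddCircle.toCircle_add]
  rw [h1]
  congr 1
  simp only [mFourier, ContinuousMap.coe_mk]
  rw [Finset.prod_eq_single i]
  · rw [Pi.single_eq_same, fourier_coe_apply]
    simp
  · intro j _ hj
    simp [Pi.single_eq_of_ne hj]
  · simp

theorem hasDerivAt_mFourier (k : Fin N → ℤ) (x : Torus N) (i : Fin N) :
    HasDerivAt (fun s : ℝ => mFourier k (x + Pi.single i (s : UnitAddCircle)))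
      (2 * Real.pi * Complex.I * k i * mFourier k x) 0 := by
  simp only [mFourier_add_single]
  have h : HasDerivAt (fun s : ℝ => (2 * Real.pi * Complex.I * k i) * (s : ℂ))
      (2 * Real.pi * Complex.I * k i) 0 := by
    simpa using (Complex.ofRealCLM.hasDerivAt (x := (0 : ℝ))).const_mul
      (2 * Real.pi * Complex.I * k i : ℂ)
  have h2 := h.cexp.const_mul (mFourier k x)
  rwa [Complex.ofReal_zero, mul_zero, Complex.exp_zero, one_mul, mul_comm (mFourier k x)] at h2

theorem contDiff_mFourier (k : Fin N → ℤ) :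
    ContDiff ℝ ∞ fun y : Fin N → ℝ => mFourier k (toTorus y) := by
  change ContDiff ℝ ∞ fun y : Fin N → ℝ => ∏ i, fourier (k i) ((y i : ℝ) : UnitAddCircle)
  refine contDiff_prod fun i _ => ?_
  have h : (fun y : Fin N → ℝ => (fourier (k i) ((y i : ℝ) : UnitAddCircle) : ℂ))
      = fun y => Complex.exp (2 * Real.pi * Complex.I * (k i) * (y i : ℝ) / (1 : ℝ)) :=
    funext fun y => fourier_coe_apply
  rw [h]
  refine ContDiff.cexp ?_
  refine ContDiff.div_const ?_ _
  refine contDiff_const.mul ?_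
  exact Complex.ofRealCLM.contDiff.comp (contDiff_apply ℝ ℝ i)

theorem isSmooth_re_mFourier (k : Fin N → ℤ) : IsSmooth fun x : Torus N => (mFourier k x).re :=
  Complex.reCLM.contDiff.comp (contDiff_mFourier k)

theorem isSmooth_im_mFourier (k : Fin N → ℤ) : IsSmooth fun x : Torus N => (mFourier k x).im :=
  Complex.imCLM.contDiff.comp (contDiff_mFourier k)

theorem grad_re_mFourier (k : Fin N → ℤ) (x : Torus N) (i : Fin N) :
    grad (fun x : Torus N => (mFourier k x).re) x i
      = (2 * Real.pi * Complex.I * k i * mFourier k x).re :=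
  (Complex.reCLM.hasFDerivAt.comp_hasDerivAt (0 : ℝ) (hasDerivAt_mFourier k x i)).deriv

theorem grad_im_mFourier (k : Fin N → ℤ) (x : Torus N) (i : Fin N) :
    grad (fun x : Torus N => (mFourier k x).im) x i
      = (2 * Real.pi * Complex.I * k i * mFourier k x).im :=
  (Complex.imCLM.hasFDerivAt.comp_hasDerivAt (0 : ℝ) (hasDerivAt_mFourier k x i)).deriv

theorem re_integral_mul_ofReal {f : Torus N → ℝ} {h : Torus N → ℂ}
    (hint : Integrable (fun x => h x * (f x : ℂ)) (torusMeasure N)) :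
    (∫ x, h x * (f x : ℂ) ∂torusMeasure N).re = ∫ x, f x * (h x).re ∂torusMeasure N := by
  rw [← Complex.reCLM_apply, ← Complex.reCLM.integral_comp_comm hint]
  simp [mul_comm]

theorem im_integral_mul_ofReal {f : Torus N → ℝ} {h : Torus N → ℂ}
    (hint : Integrable (fun x => h x * (f x : ℂ)) (torusMeasure N)) :
    (∫ x, h x * (f x : ℂ) ∂torusMeasure N).im = ∫ x, f x * (h x).im ∂torusMeasure N := by
  rw [← Complex.imCLM_apply, ← Complex.imCLM.integral_comp_comm hint]
  simp [mul_comm]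

theorem memLp_apply {G : Torus N → EuclideanSpace ℝ (Fin N)} {q : ℝ≥0∞}
    (hG : MemLp G q (torusMeasure N)) (i : Fin N) : MemLp (fun x => G x i) q (torusMeasure N) :=
  (EuclideanSpace.proj (𝕜 := ℝ) i : EuclideanSpace ℝ (Fin N) →L[ℝ] ℝ).comp_memLp' hG

/-- The Fourier coefficients of a weak gradient. -/
theorem IsWeakGrad.torusCoeff_apply {f : Torus N → ℝ} {G : Torus N → EuclideanSpace ℝ (Fin N)}
    (h : IsWeakGrad f G) (hf : MemLp f 2 (torusMeasure N)) (hG : MemLp G 2 (torusMeasure N))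
    (k : Fin N → ℤ) (i : Fin N) :
    torusCoeff (fun x => G x i) k = 2 * Real.pi * Complex.I * k i * torusCoeff f k := by
  have hfi : Integrable f (torusMeasure N) := hf.integrable (by norm_num)
  have hGi : Integrable (fun x => G x i) (torusMeasure N) :=
    (memLp_apply hG i).integrable (by norm_num)
  have i1 := integrable_mFourier_mul_ofReal hfi (-k)
  have i2 := integrable_mFourier_mul_ofReal hGi (-k)
  have i3 : Integrable (fun x => (2 * Real.pi * Complex.I * ((-k) i : ℤ) * mFourier (-k) x) * (f x : ℂ))
      (torusMeasure N) := by
    simpa only [mul_assoc] using i1.const_mul (2 * Real.pi * Complex.I * ((-k) i : ℤ))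
  -- Test functions are real, so the exponential is tested through its real and imaginary parts
  -- separately.
  have key : ∫ x, (2 * Real.pi * Complex.I * ((-k) i : ℤ) * mFourier (-k) x) * (f x : ℂ)
      ∂torusMeasure N = -∫ x, mFourier (-k) x * (G x i : ℂ) ∂torusMeasure N := by
    apply Complex.ext
    · have h1 := h _ (isSmooth_re_mFourier (-k)) i
      simp only [grad_re_mFourier] at h1
      rw [re_integral_mul_ofReal i3, h1, Complex.neg_re, re_integral_mul_ofReal i2]
    · have h1 := h _ (isSmooth_im_mFourier (-k)) i
      simp only [grad_im_mFourier] at h1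
      rw [im_integral_mul_ofReal i3, h1, Complex.neg_im, im_integral_mul_ofReal i2]
  rw [torusCoeff_eq, torusCoeff_eq, ← integral_const_mul, ← neg_eq_iff_eq_neg.2 key,
    ← integral_neg]
  congr 1; funext x; push_cast [Pi.neg_apply]; ring

/-- Testing with the exponential of frequency `m`, again through real and imaginary parts, shows
that the coefficient vector at `-m` is orthogonal to `m`. -/
theorem IsDivFree.sum_torusCoeff {w : Torus N → EuclideanSpace ℝ (Fin N)} (hw : IsDivFree w)
    (hi : Integrable w (torusMeasure N)) (m : Fin N → ℤ) :
    ∑ j, (m j : ℂ) * torusCoeff (fun x => w x j) (-m) = 0 := by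
  have hij : ∀ j, Integrable (fun x => w x j) (torusMeasure N) := fun j =>
    ((memLp_one_iff_integrable.2 hi) |> fun h => memLp_one_iff_integrable.1 (memLp_apply h j))
  have i3 : ∀ j, Integrable (fun x => (2 * Real.pi * Complex.I * (m j) * mFourier m x)
      * (w x j : ℂ)) (torusMeasure N) := fun j => by
    simpa only [mul_assoc] using (integrable_mFourier_mul_ofReal (hij j) m).const_mul
      (2 * Real.pi * Complex.I * (m j))
  have key : ∑ j, ∫ x, (2 * Real.pi * Complex.I * (m j) * mFourier m x)
      * (w x j : ℂ) ∂torusMeasure N = 0 := by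
    apply Complex.ext
    · have h1 := hw _ (isSmooth_re_mFourier m)
      simp only [PiLp.inner_apply, grad_re_mFourier] at h1
      rw [Complex.re_sum, Complex.zero_re, ← h1, integral_finsetSum]
      · refine Finset.sum_congr rfl fun j _ => ?_
        rw [re_integral_mul_ofReal (i3 j)]
        simp [mul_comm]
      · intro j _
        convert (i3 j).re using 2
        simp
    · have h1 := hw _ (isSmooth_im_mFourier m)
      simp only [PiLp.inner_apply, grad_im_mFourier] at h1
      rw [Complex.im_sum, Complex.zero_im, ← h1, integral_finsetSum]
      · refine Finset.sum_congr rfl fun j _ => ?_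
        rw [im_integral_mul_ofReal (i3 j)]
        simp [mul_comm]
      · intro j _
        convert (i3 j).im using 2
        simp
  have hc : (2 * Real.pi * Complex.I : ℂ) ≠ 0 := by simp [Real.pi_ne_zero]
  refine (mul_eq_zero.1 ?_).resolve_left hc
  rw [← key, Finset.mul_sum]
  refine Finset.sum_congr rfl fun j _ => ?_
  rw [torusCoeff_eq, neg_neg, ← mul_assoc, ← integral_const_mul]
  congr 1; funext x; ring

/-! ### Cancellations for divergence free transport -/

theorem memLp_bdd_mul {w f : Torus N → ℝ} {V : ℝ} (hw : AEStronglyMeasurable w (torusMeasure N))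
    (hV : ∀ᵐ x ∂torusMeasure N, ‖w x‖ ≤ V) (hf : MemLp f 2 (torusMeasure N)) :
    MemLp (fun x => w x * f x) 2 (torusMeasure N) :=
  MemLp.mul' hf (memLp_top_of_bound hw V hV)

section DivFree

variable {w : Torus N → EuclideanSpace ℝ (Fin N)} {V : ℝ} {f : Torus N → ℝ}
  {G : Torus N → EuclideanSpace ℝ (Fin N)}

/-- The Fourier form of `w·∇f = div (w f)`. Expanding both products by Parseval, the `k`-th term is
`2πi f̂(k)` times `(k+l)·ŵ(-(k+l))`, which vanishes. No product rule for weak derivatives is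
involved. -/
theorem IsDivFree.sum_torusCoeff_mul (hw : IsDivFree w)
    (hwm : AEStronglyMeasurable w (torusMeasure N)) (hV : ∀ᵐ x ∂torusMeasure N, ‖w x‖ ≤ V)
    (hf : MemLp f 2 (torusMeasure N)) (hG : MemLp G 2 (torusMeasure N)) (h : IsWeakGrad f G)
    (l : Fin N → ℤ) :
    ∑ j, (torusCoeff (fun x => w x j * G x j) (-l)
      + 2 * Real.pi * Complex.I * l j * torusCoeff (fun x => w x j * f x) (-l)) = 0 := by
  have hwi : MemLp w ⊤ (torusMeasure N) := memLp_top_of_bound hwm V hV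
  have hwe : ∀ j, MemLp (fun x => mFourier l x * (w x j : ℂ)) 2 (torusMeasure N) := fun j => by
    refine MemLp.mul' (p := ⊤) (q := 2) (((memLp_apply hwi j).mono_exponent le_top).ofReal) ?_
    exact memLp_top_of_bound (mFourier l).continuous.aestronglyMeasurable 1
      (Eventually.of_forall fun x => (norm_mFourier_apply l x).le)
  have hco : ∀ j k, mFourierCoeff (fun x => mFourier l x * (w x j : ℂ)) (-k)
      = torusCoeff (fun x => w x j) (-(k + l)) := fun j k => by
    rw [mFourierCoeff_eq, torusCoeff_eq]
    congr 1; funext x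
    rw [neg_neg, neg_neg, mFourier_add]; ring
  have hs1 : ∀ j, HasSum (fun k => 2 * Real.pi * Complex.I * k j * torusCoeff f k
      * torusCoeff (fun x => w x j) (-(k + l)))
      (torusCoeff (fun x => w x j * G x j) (-l)) := fun j => by
    convert hasSum_mFourierCoeff_mul (memLp_apply hG j).ofReal (hwe j) using 1
    · funext k
      rw [hco, ← h.torusCoeff_apply hf hG k j]; rfl
    · rw [torusCoeff_eq]; congr 1; funext x
      push_cast; rw [neg_neg]; simp; ring
  have hs2 : ∀ j, HasSum (fun k => torusCoeff f k
      * torusCoeff (fun x => w x j) (-(k + l)))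
      (torusCoeff (fun x => w x j * f x) (-l)) := fun j => by
    convert hasSum_mFourierCoeff_mul hf.ofReal (hwe j) using 1
    · funext k
      rw [hco]; rfl
    · rw [torusCoeff_eq]; congr 1; funext x
      push_cast; rw [neg_neg]; simp; ring
  have hs := hasSum_sum fun j (_ : j ∈ Finset.univ) =>
    (hs1 j).add ((hs2 j).mul_left (2 * Real.pi * Complex.I * (l j : ℂ)))
  refine hs.unique ?_
  convert hasSum_zero using 1
  funext k
  have := hw.sum_torusCoeff ((hwi.mono_exponent le_top).integrable le_rfl) (k + l)
  rw [← mul_zero (2 * Real.pi * Complex.I * torusCoeff f k), ← this, Finset.mul_sum]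
  refine Finset.sum_congr rfl fun j _ => ?_
  push_cast [Pi.add_apply]; ring

theorem ae_norm_apply_le (hV : ∀ᵐ x ∂torusMeasure N, ‖w x‖ ≤ V) (j : Fin N) :
    ∀ᵐ x ∂torusMeasure N, ‖w x j‖ ≤ V :=
  hV.mono fun x hx => (PiLp.norm_apply_le (w x) j).trans hx

/-- A bounded divergence free field transports without creating mass. -/
theorem IsDivFree.integral_inner_eq_zero (hw : IsDivFree w)
    (hwm : AEStronglyMeasurable w (torusMeasure N)) (hV : ∀ᵐ x ∂torusMeasure N, ‖w x‖ ≤ V)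
    (hf : MemLp f 2 (torusMeasure N)) (hG : MemLp G 2 (torusMeasure N)) (h : IsWeakGrad f G) :
    ∫ x, inner ℝ (w x) (G x) ∂torusMeasure N = 0 := by
  have hwi : MemLp w ⊤ (torusMeasure N) := memLp_top_of_bound hwm V hV
  -- At frequency `0` the divergence part disappears and only the mean of `w·∇f` remains.
  have hk := hw.sum_torusCoeff_mul hwm hV hf hG h 0
  simp only [neg_zero, torusCoeff_zero, Pi.zero_apply, Int.cast_zero, mul_zero, zero_mul,
    add_zero] at hk
  have hi : ∀ j, Integrable (fun x => w x j * G x j) (torusMeasure N) := fun j =>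
    (memLp_bdd_mul (memLp_apply hwi j).1 (ae_norm_apply_le hV j)
      (memLp_apply hG j)).integrable (by norm_num)
  have h2 : ∫ x, inner ℝ (w x) (G x) ∂torusMeasure N = ∑ j, ∫ x, w x j * G x j ∂torusMeasure N := by
    rw [← integral_finsetSum _ fun j _ => hi j]
    simp [PiLp.inner_apply, mul_comm]
  rw [h2]
  exact_mod_cast hk

/-- A bounded divergence free field transports without creating energy. -/
theorem IsDivFree.integral_mul_inner_eq_zero (hw : IsDivFree w)
    (hwm : AEStronglyMeasurable w (torusMeasure N)) (hV : ∀ᵐ x ∂torusMeasure N, ‖w x‖ ≤ V)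
    (hf : MemLp f 2 (torusMeasure N)) (hG : MemLp G 2 (torusMeasure N)) (h : IsWeakGrad f G) :
    ∫ x, f x * inner ℝ (w x) (G x) ∂torusMeasure N = 0 := by
  have hwi : MemLp w ⊤ (torusMeasure N) := memLp_top_of_bound hwm V hV
  have hwG : ∀ j, MemLp (fun x => w x j * G x j) 2 (torusMeasure N) := fun j =>
    memLp_bdd_mul (memLp_apply hwi j).1 (ae_norm_apply_le hV j) (memLp_apply hG j)
  have hwf : ∀ j, MemLp (fun x => w x j * f x) 2 (torusMeasure N) := fun j =>
    memLp_bdd_mul (memLp_apply hwi j).1 (ae_norm_apply_le hV j) hf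
  -- The same integral is expanded in two ways, as `f` against `w_j ∂_j f` and as `∂_j f` against
  -- `w_j f`. The two series add up termwise to zero, so twice the integral vanishes.
  have hs1 : ∀ j, HasSum (fun l => torusCoeff f l * torusCoeff (fun x => w x j * G x j) (-l))
      ((∫ x, f x * (w x j * G x j) ∂torusMeasure N : ℝ) : ℂ) := fun j => by
    simpa only [torusCoeff_neg] using hasSum_torusCoeff_mul hf (hwG j)
  have hs2 : ∀ j, HasSum (fun l => 2 * Real.pi * Complex.I * l j * torusCoeff f l
      * torusCoeff (fun x => w x j * f x) (-l))
      ((∫ x, f x * (w x j * G x j) ∂torusMeasure N : ℝ) : ℂ) := fun j => by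
    convert hasSum_torusCoeff_mul (memLp_apply hG j) (hwf j) using 1
    · funext l
      rw [h.torusCoeff_apply hf hG l j, torusCoeff_neg]
    · congr 2; funext x; ring
  have hs := hasSum_sum fun j (_ : j ∈ Finset.univ) => (hs1 j).add (hs2 j)
  have h0 := hs.unique (a₂ := 0) (by
    convert hasSum_zero using 1
    funext l
    rw [← mul_zero (torusCoeff f l), ← hw.sum_torusCoeff_mul hwm hV hf hG h l, Finset.mul_sum]
    refine Finset.sum_congr rfl fun j _ => ?_
    ring)
  have hi : ∀ j, Integrable (fun x => f x * (w x j * G x j)) (torusMeasure N) := fun j =>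
    hf.integrable_mul (hwG j)
  have h2 : ∫ x, f x * inner ℝ (w x) (G x) ∂torusMeasure N
      = ∑ j, ∫ x, f x * (w x j * G x j) ∂torusMeasure N := by
    rw [← integral_finsetSum _ fun j _ => hi j]
    simp [PiLp.inner_apply, mul_comm, Finset.mul_sum]
  rw [h2]
  have h3 : ∑ j, ((∫ x, f x * (w x j * G x j) ∂torusMeasure N)
      + ∫ x, f x * (w x j * G x j) ∂torusMeasure N) = 0 := by exact_mod_cast h0
  rw [Finset.sum_add_distrib] at h3
  linarith

end DivFree

/-! ### Classical gradients and space-time test functions -/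

/-- `grad` differentiates only at parameter `0`; shifting the base point gives the derivative along
the whole coordinate line. -/
theorem IsSmooth.hasDerivAt_add_single {ψ : Torus N → ℝ} (h : IsSmooth ψ) (x : Torus N)
    (i : Fin N) (s : ℝ) :
    HasDerivAt (fun r : ℝ => ψ (x + Pi.single i (r : UnitAddCircle)))
      (grad ψ (x + Pi.single i (s : UnitAddCircle)) i) s := by
  obtain ⟨y, rfl⟩ := isOpenQuotientMap_toTorus.surjective x
  have hd : ∀ s₀ : ℝ, ∀ z : Fin N → ℝ, DifferentiableAt ℝ
      (fun r : ℝ => ψ (toTorus z + Pi.single i (r : UnitAddCircle))) s₀ := fun s₀ z => by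
    simp only [toTorus_add_single]
    exact ((h.differentiable (by simp)).comp (by fun_prop : Differentiable ℝ
      fun r : ℝ => z + r • (Pi.single i 1 : Fin N → ℝ))).differentiableAt
  have h1 := (hd 0 (y + s • Pi.single i 1)).hasDerivAt
  have h2 : grad ψ (toTorus y + Pi.single i (s : UnitAddCircle)) i =
    deriv (fun r : ℝ => ψ (toTorus (y + s • Pi.single i 1)
      + Pi.single i (r : UnitAddCircle))) 0 := by
    rw [toTorus_add_single]; rfl
  rw [h2]
  have h3 : (fun r : ℝ => ψ (toTorus y + Pi.single i (r : UnitAddCircle)))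
      = fun r : ℝ => (fun r : ℝ => ψ (toTorus (y + s • Pi.single i 1)
      + Pi.single i (r : UnitAddCircle))) (r - s) := by
    funext r
    simp only [toTorus_add_single]
    congr 2
    rw [add_assoc, ← add_smul]
    simp
  rw [h3]
  rw [← sub_self s] at h1
  simpa only [sub_self] using h1.comp_sub_const s s

theorem hasDerivAt_integral_torus {H H' : ℝ → Torus N → ℂ} (hc : Continuous (Function.uncurry H))
    (hc' : Continuous (Function.uncurry H'))
    (hd : ∀ s x, HasDerivAt (fun r => H r x) (H' s x) s) (s : ℝ) :
    HasDerivAt (fun r => ∫ x, H r x ∂torusMeasure N) (∫ x, H' s x ∂torusMeasure N) s := by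
  obtain ⟨C, hC⟩ := ((isCompact_Icc (a := s - 1) (b := s + 1)).prod
    (isCompact_univ (X := Torus N))).exists_bound_of_continuousOn hc'.continuousOn
  have hcs : ∀ r, Continuous (H r) := fun r => hc.comp (by fun_prop : Continuous fun x => (r, x))
  have hcs' : ∀ r, Continuous (H' r) := fun r => hc'.comp (by fun_prop : Continuous fun x => (r, x))
  refine (hasDerivAt_integral_of_dominated_loc_of_deriv_le (μ := torusMeasure N)
    (bound := fun _ => C) (Icc_mem_nhds (by linarith : s - 1 < s) (by linarith : s < s + 1))
    (Eventually.of_forall fun r => (hcs r).aestronglyMeasurable) ?_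
    (hcs' s).aestronglyMeasurable ?_ (integrable_const C) ?_).2
  · exact (hcs s).integrable_of_hasCompactSupport (HasCompactSupport.of_compactSpace _)
  · exact Eventually.of_forall fun x r hr => hC (r, x) ⟨hr, mem_univ _⟩
  · exact Eventually.of_forall fun x r _ => hd r x

theorem continuous_integral_torus {H : ℝ → Torus N → ℂ} (hc : Continuous (Function.uncurry H)) :
    Continuous fun r => ∫ x, H r x ∂torusMeasure N := by
  simpa using continuous_parametric_integral_of_continuous (μ := torusMeasure N) hc
    (isCompact_univ (X := Torus N))

/-- The Fourier coefficients of the classical gradient of a smooth function. -/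
theorem IsSmooth.torusCoeff_grad {ψ : Torus N → ℝ} (h : IsSmooth ψ) (hc : Continuous ψ)
    (hg : ∀ i, Continuous fun x => grad ψ x i) (k : Fin N → ℤ) (i : Fin N) :
    torusCoeff (fun x => grad ψ x i) k = 2 * Real.pi * Complex.I * k i * torusCoeff ψ k := by
  have ha := continuous_add_single (N := N) i
  have hd : ∀ (s : ℝ) (x : Torus N), HasDerivAt
      (fun r : ℝ => mFourier (-k) x * (ψ (x + Pi.single i (r : UnitAddCircle)) : ℂ))
      (mFourier (-k) x * ((grad ψ (x + Pi.single i (s : UnitAddCircle)) i : ℝ) : ℂ)) s := by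
    intro s x
    have h0 := (h.hasDerivAt_add_single x i s).ofReal_comp
    exact h0.const_mul (mFourier (-k) x)
  have hc1 : Continuous fun z : ℝ × Torus N => ψ (z.2 + Pi.single i (z.1 : UnitAddCircle)) :=
    hc.comp ha
  have hc2 : Continuous fun z : ℝ × Torus N =>
      grad ψ (z.2 + Pi.single i (z.1 : UnitAddCircle)) i := (hg i).comp ha
  have he : Continuous fun z : ℝ × Torus N => mFourier (-k) z.2 :=
    (mFourier (-k)).continuous.comp continuous_snd
  set H : ℝ → Torus N → ℂ :=
    fun s x => mFourier (-k) x * (ψ (x + Pi.single i (s : UnitAddCircle)) : ℂ) with hH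
  set H' : ℝ → Torus N → ℂ := fun s x => mFourier (-k) x *
      ((grad ψ (x + Pi.single i (s : UnitAddCircle)) i : ℝ) : ℂ) with hH'
  have hcH : Continuous (Function.uncurry H) := he.mul (Complex.continuous_ofReal.comp hc1)
  have hcH' : Continuous (Function.uncurry H') := he.mul (Complex.continuous_ofReal.comp hc2)
  have h1 := hasDerivAt_integral_torus hcH hcH' hd 0
  -- By translation invariance, shifting `ψ` by `s` multiplies its coefficient by `e^{2πi k_i s}`.
  -- Differentiating at `s = 0` here and under the integral gives the formula without an integration
  -- by parts on the torus.
  have h2 : ∀ s : ℝ, ∫ x, H s x ∂torusMeasure N = Complex.exp (2 * Real.pi * Complex.I * k i * s) * torusCoeff ψ k := fun s => by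
    rw [torusCoeff_eq, ← integral_const_mul,
      ← integral_add_right_eq_self (μ := torusMeasure N)
        (fun x => Complex.exp (2 * Real.pi * Complex.I * k i * s) * (mFourier (-k) x * (ψ x : ℂ)))
        (Pi.single i (s : UnitAddCircle))]
    congr 1; funext x
    rw [hH, mFourier_add_single]
    have : Complex.exp (2 * Real.pi * Complex.I * k i * s)
        * Complex.exp (2 * Real.pi * Complex.I * ((-k) i : ℤ) * s) = 1 := by
      rw [← Complex.exp_add, Pi.neg_apply]
      push_cast
      rw [← Complex.exp_zero]; congr 1; ring
    linear_combination (-(mFourier (-k) x * (ψ (x + Pi.single i (s : UnitAddCircle)) : ℂ))) * this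
  rw [funext h2] at h1
  have h3 : HasDerivAt (fun s : ℝ => (2 * Real.pi * Complex.I * k i) * (s : ℂ))
      (2 * Real.pi * Complex.I * k i) 0 := by
    simpa using (Complex.ofRealCLM.hasDerivAt (x := (0 : ℝ))).const_mul
      (2 * Real.pi * Complex.I * k i : ℂ)
  have h4 := h3.cexp.mul_const (torusCoeff ψ k)
  rw [Complex.ofReal_zero, mul_zero, Complex.exp_zero, one_mul] at h4
  rw [h4.unique h1, torusCoeff_eq]
  simp [hH']

namespace IsTestFunction

variable {T : ℝ} {φ : ℝ → Torus N → ℝ}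

theorem isOpenQuotientMap_prod_toTorus :
    IsOpenQuotientMap fun z : ℝ × (Fin N → ℝ) => (z.1, toTorus z.2) :=
  IsOpenQuotientMap.id.prodMap isOpenQuotientMap_toTorus

theorem continuous_uncurry (h : IsTestFunction T φ) : Continuous (Function.uncurry φ) :=
  isOpenQuotientMap_prod_toTorus.isQuotientMap.continuous_iff.2 h.1.continuous

theorem isSmooth (h : IsTestFunction T φ) (t : ℝ) : IsSmooth (φ t) :=
  h.1.comp (contDiff_prodMk_right t)

theorem hasDerivAt_fderiv (h : IsTestFunction T φ) (t : ℝ) (y : Fin N → ℝ) :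
    HasDerivAt (fun s => φ s (toTorus y))
      (fderiv ℝ (fun z : ℝ × (Fin N → ℝ) => φ z.1 (toTorus z.2)) (t, y) (1, 0)) t := by
  have h1 := ((h.1.differentiable (by simp)) (t, y)).hasFDerivAt
  exact h1.comp_hasDerivAt (f := fun s : ℝ => (s, y)) t
    ((hasDerivAt_id t).prodMk (hasDerivAt_const t y))

theorem hasDerivAt (h : IsTestFunction T φ) (t : ℝ) (x : Torus N) :
    HasDerivAt (fun s => φ s x) (deriv (fun s => φ s x) t) t := by
  obtain ⟨y, rfl⟩ := isOpenQuotientMap_toTorus.surjective x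
  exact (h.hasDerivAt_fderiv t y).differentiableAt.hasDerivAt

theorem continuous_deriv (h : IsTestFunction T φ) :
    Continuous (Function.uncurry fun t x => deriv (fun s => φ s x) t) := by
  refine isOpenQuotientMap_prod_toTorus.isQuotientMap.continuous_iff.2 ?_
  have h1 : Continuous fun z : ℝ × (Fin N → ℝ) =>
      fderiv ℝ (fun z : ℝ × (Fin N → ℝ) => φ z.1 (toTorus z.2)) z (1, 0) :=
    (h.1.continuous_fderiv (by simp)).clm_apply continuous_const
  convert h1 using 1
  funext z
  exact (h.hasDerivAt_fderiv z.1 z.2).deriv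

theorem continuous_grad (h : IsTestFunction T φ) (i : Fin N) :
    Continuous (Function.uncurry fun t x => grad (φ t) x i) := by
  refine isOpenQuotientMap_prod_toTorus.isQuotientMap.continuous_iff.2 ?_
  have h1 : Continuous fun z : ℝ × (Fin N → ℝ) =>
      fderiv ℝ (fun z : ℝ × (Fin N → ℝ) => φ z.1 (toTorus z.2)) z (0, Pi.single i 1) :=
    (h.1.continuous_fderiv (by simp)).clm_apply continuous_const
  convert h1 using 1
  funext z
  have h2 := ((h.1.differentiable (by simp)) z).hasFDerivAt
  have h3 : HasDerivAt (fun s : ℝ => (z.1, z.2 + s • (Pi.single i 1 : Fin N → ℝ)))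
      ((0 : ℝ), (Pi.single i 1 : Fin N → ℝ)) 0 := by
    refine (hasDerivAt_const (0 : ℝ) z.1).prodMk ?_
    simpa using ((hasDerivAt_id (0 : ℝ)).smul_const (Pi.single i 1 : Fin N → ℝ)).const_add z.2
  have h4 := HasFDerivAt.comp_hasDerivAt (f := fun s : ℝ => (z.1, z.2 + s • (Pi.single i 1 : Fin N → ℝ)))
    (0 : ℝ) (by simpa using h2) h3
  have h5 := h4.deriv
  simp only [Function.comp_def] at h5
  simp only [Function.comp_apply, Function.uncurry_apply_pair, grad, toTorus_add_single]
  exact h5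

theorem continuous_apply (h : IsTestFunction T φ) (t : ℝ) : Continuous (φ t) :=
  h.continuous_uncurry.comp (by fun_prop : Continuous fun x => (t, x))

theorem torusCoeff_grad (h : IsTestFunction T φ) (t : ℝ) (k : Fin N → ℤ) (i : Fin N) :
    torusCoeff (fun x => grad (φ t) x i) k
      = 2 * Real.pi * Complex.I * k i * torusCoeff (φ t) k :=
  (h.isSmooth t).torusCoeff_grad (h.continuous_apply t) (fun i =>
    (h.continuous_grad i).comp (by fun_prop : Continuous fun x => (t, x))) k i

end IsTestFunction

theorem continuous_torusCoeff {φ : ℝ → Torus N → ℝ} (h : Continuous (Function.uncurry φ))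
    (k : Fin N → ℤ) : Continuous fun t => torusCoeff (φ t) k := by
  simp only [torusCoeff_eq]
  exact continuous_integral_torus (((mFourier (-k)).continuous.comp continuous_snd).mul
    (Complex.continuous_ofReal.comp h))

theorem IsTestFunction.hasDerivAt_torusCoeff {T : ℝ} {φ : ℝ → Torus N → ℝ}
    (h : IsTestFunction T φ) (k : Fin N → ℤ) (t : ℝ) :
    HasDerivAt (fun s => torusCoeff (φ s) k)
      (torusCoeff (fun x => deriv (fun s => φ s x) t) k) t := by
  simp only [torusCoeff_eq]
  exact hasDerivAt_integral_torus
    (H := fun s x => mFourier (-k) x * (φ s x : ℂ))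
    (H' := fun s x => mFourier (-k) x * ((deriv (fun s => φ s x) s : ℝ) : ℂ))
    (((mFourier (-k)).continuous.comp continuous_snd).mul
      (Complex.continuous_ofReal.comp h.continuous_uncurry))
    (((mFourier (-k)).continuous.comp continuous_snd).mul
      (Complex.continuous_ofReal.comp h.continuous_deriv))
    (fun s x => ((h.hasDerivAt s x).ofReal_comp).const_mul _) t

/-! ### Product rule and Duhamel's formula for primitives of integrable functions -/

section Primitives

variable {f g a b α β : ℝ → ℂ} {s t T : ℝ}

/-- Integration by parts for primitives of integrable functions. -/
theorem integral_mul_integral_eq (hst : s ≤ t) (hf : IntervalIntegrable f volume s t)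
    (hg : IntervalIntegrable g volume s t) :
    (∫ τ in s..t, f τ) * (∫ τ in s..t, g τ) =
      ∫ τ in s..t, (f τ * (∫ r in s..τ, g r) + (∫ r in s..τ, f r) * g τ) := by
  have hf' := (intervalIntegrable_iff_integrableOn_Ioc_of_le hst).1 hf
  have hg' := (intervalIntegrable_iff_integrableOn_Ioc_of_le hst).1 hg
  have hK : Integrable (fun z : ℝ × ℝ => f z.1 * g z.2)
    ((volume.restrict (Ioc s t)).prod (volume.restrict (Ioc s t))) := hf'.mul_prod hg'
  -- The product is a double integral over the square, split by Fubini along the diagonal: one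
  -- triangle gives each term of the right-hand side.
  have hA : MeasurableSet {z : ℝ × ℝ | z.2 ≤ z.1} := measurableSet_le measurable_snd measurable_fst
  have h1 := integral_add_compl hA hK
  rw [integral_prod_mul, ← integral_indicator hA, ← integral_indicator hA.compl,
    integral_prod _ (hK.indicator hA), integral_prod_symm _ (hK.indicator hA.compl)] at h1
  have e1 : ∀ x ∈ Ioc s t, ∫ y in Ioc s t, {z : ℝ × ℝ | z.2 ≤ z.1}.indicator
      (fun z : ℝ × ℝ => f z.1 * g z.2) (x, y) = f x * ∫ r in s..x, g r := fun x hx => by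
    have : (fun y => {z : ℝ × ℝ | z.2 ≤ z.1}.indicator (fun z : ℝ × ℝ => f z.1 * g z.2) (x, y))
        = (Iic x).indicator fun y => f x * g y := by
      funext y; simp [indicator]
    rw [this, setIntegral_indicator measurableSet_Iic, Ioc_inter_Iic, min_eq_right hx.2,
      intervalIntegral.integral_of_le hx.1.le, integral_const_mul]
  have e2 : ∀ y ∈ Ioc s t, ∫ x in Ioc s t, {z : ℝ × ℝ | z.2 ≤ z.1}ᶜ.indicator
      (fun z : ℝ × ℝ => f z.1 * g z.2) (x, y) = (∫ r in s..y, f r) * g y := fun y hy => by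
    have : (fun x => {z : ℝ × ℝ | z.2 ≤ z.1}ᶜ.indicator (fun z : ℝ × ℝ => f z.1 * g z.2) (x, y))
        = (Iio y).indicator fun x => f x * g y := by
      funext x; simp [indicator]
    have h2 : Ioc s t ∩ Iio y = Ioo s y := by
      ext x; simp only [mem_inter_iff, mem_Ioc, mem_Iio, mem_Ioo]
      exact ⟨fun h => ⟨h.1.1, h.2⟩, fun h => ⟨⟨h.1, h.2.le.trans hy.2⟩, h.2⟩⟩
    rw [this, setIntegral_indicator measurableSet_Iio, h2, ← integral_Ioc_eq_integral_Ioo,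
      intervalIntegral.integral_of_le hy.1.le, integral_mul_const]
  have i1 := (hK.indicator hA).integral_prod_left
  have i2 := (hK.indicator hA.compl).integral_prod_right
  rw [intervalIntegral.integral_of_le hst, intervalIntegral.integral_of_le hst,
    intervalIntegral.integral_of_le hst, ← h1, ← integral_add i1 i2]
  refine setIntegral_congr_fun measurableSet_Ioc fun x hx => ?_
  exact congrArg₂ (· + ·) (e1 x hx) (e2 x hx)

/-- Product rule for primitives of integrable functions. -/
theorem mul_sub_mul_eq_integral (hst : s ≤ t) (hα : IntervalIntegrable α volume s t)
    (hβ : IntervalIntegrable β volume s t)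
    (ha : ∀ τ ∈ Icc s t, a τ = a s + ∫ r in s..τ, α r)
    (hb : ∀ τ ∈ Icc s t, b τ = b s + ∫ r in s..τ, β r) :
    a t * b t - a s * b s = ∫ τ in s..t, (α τ * b τ + a τ * β τ) := by
  have hc : ∀ {γ : ℝ → ℂ}, IntervalIntegrable γ volume s t →
      ContinuousOn (fun τ => ∫ r in s..τ, γ r) (uIcc s t) := fun h =>
    intervalIntegral.continuousOn_primitive_interval' h left_mem_uIcc
  -- Inserting the formulas for `a` and `b` separates terms linear in one increment from the product
  -- of the two increments, which is the previous lemma.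
  have h1 : ∫ τ in s..t, (α τ * b τ + a τ * β τ)
      = ∫ τ in s..t, ((α τ * b s + a s * β τ)
        + (α τ * (∫ r in s..τ, β r) + (∫ r in s..τ, α r) * β τ)) := by
    refine intervalIntegral.integral_congr fun τ hτ => ?_
    rw [uIcc_of_le hst] at hτ
    simp only [ha τ hτ, hb τ hτ]
    ring
  rw [h1, intervalIntegral.integral_add, intervalIntegral.integral_add,
    intervalIntegral.integral_mul_const, intervalIntegral.integral_const_mul,
    ← integral_mul_integral_eq hst hα hβ, ha t (right_mem_Icc.2 hst), hb t (right_mem_Icc.2 hst)]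
  · ring
  · exact hα.mul_const _
  · exact hβ.const_mul _
  · exact (hα.mul_const _).add (hβ.const_mul _)
  · exact (hα.mul_continuousOn (hc hβ)).add (hβ.continuousOn_mul (hc hα))

/-- A function given by Duhamel's formula satisfies the integrated differential equation. -/
theorem eq_add_integral_of_duhamel {l : ℝ} (hg : IntervalIntegrable g volume 0 T)
    (ha : ∀ t ∈ Icc 0 T, a t = (Real.exp (-l * t) : ℂ) * a 0
      + ∫ τ in (0 : ℝ)..t, (Real.exp (-l * (t - τ)) : ℂ) * g τ) (ht : t ∈ Icc 0 T) :
    a t = a 0 + ∫ τ in (0 : ℝ)..t, (-l * a τ + g τ) := by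
  have he : ∀ c : ℝ, Continuous fun τ : ℝ => (Real.exp (c * τ) : ℂ) := fun c => by fun_prop
  -- Integrating factor: `B τ = e^{lτ} a(τ)` is a primitive, and the product rule is applied to `a =
  -- e^{-lτ} B`.
  set B : ℝ → ℂ := fun τ => a 0 + ∫ r in (0 : ℝ)..τ, (Real.exp (l * r) : ℂ) * g r with hB
  have haB : ∀ τ ∈ Icc 0 T, a τ = (Real.exp (-l * τ) : ℂ) * B τ := fun τ hτ => by
    rw [ha τ hτ, hB]
    simp only [mul_add]
    rw [← intervalIntegral.integral_const_mul]
    congr 2; funext r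
    rw [← mul_assoc, ← Complex.ofReal_mul, ← Real.exp_add]
    congr 4; ring
  have hgt : IntervalIntegrable g volume 0 t := hg.mono_set (by
    rw [uIcc_of_le ht.1, uIcc_of_le (ht.1.trans ht.2)]; exact Icc_subset_Icc_right ht.2)
  have hd : ∀ τ : ℝ, HasDerivAt (fun τ : ℝ => (Real.exp (-l * τ) : ℂ))
      ((-l : ℂ) * (Real.exp (-l * τ) : ℂ)) τ := fun τ => by
    have h := (((hasDerivAt_id' τ).const_mul (-l)).exp).ofReal_comp
    convert h using 1
    push_cast; ring
  have hcd : Continuous fun τ : ℝ => (-l : ℂ) * (Real.exp (-l * τ) : ℂ) :=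
    continuous_const.mul (he _)
  have h := mul_sub_mul_eq_integral (a := fun τ => (Real.exp (-l * τ) : ℂ)) (b := B)
    (α := fun τ => (-l : ℂ) * (Real.exp (-l * τ) : ℂ))
    (β := fun r => (Real.exp (l * r) : ℂ) * g r) ht.1
    (hcd.intervalIntegrable _ _) (hgt.continuousOn_mul (he l).continuousOn)
    (fun τ _ => by
      rw [intervalIntegral.integral_eq_sub_of_hasDerivAt (fun x _ => hd x)
        (hcd.intervalIntegrable _ _)]
      ring)
    (fun τ _ => by simp [hB])
  rw [← haB t ht] at h
  have h0 : (Real.exp (-l * 0) : ℂ) * B 0 = a 0 := by simp [hB]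
  rw [h0, sub_eq_iff_eq_add'] at h
  rw [h]
  congr 1
  refine intervalIntegral.integral_congr fun τ hτ => ?_
  rw [uIcc_of_le ht.1] at hτ
  have h2 : (Real.exp (-l * τ) : ℂ) * (Real.exp (l * τ) : ℂ) = 1 := by
    rw [← Complex.ofReal_mul, ← Real.exp_add]; simp
  simp only [haB τ ⟨hτ.1, hτ.2.trans ht.2⟩]
  linear_combination g τ * h2

end Primitives

/-! ### A Gagliardo–Nirenberg inequality by frequency truncation -/

/-- The frequencies with `|kᵢ| ≤ n` for all `i`. -/
def freqBox (N n : ℕ) : Finset (Fin N → ℤ) :=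
  Fintype.piFinset fun _ => Finset.Icc (-(n : ℤ)) n

theorem card_freqBox (n : ℕ) : (freqBox N n).card = (2 * n + 1) ^ N := by
  have h : ((n : ℤ) + 1 + (n : ℤ)).toNat = 2 * n + 1 := by omega
  simp [freqBox, Fintype.card_piFinset, h]

theorem le_eig_of_notMem_freqBox {n : ℕ} {k : Fin N → ℤ} (hk : k ∉ freqBox N n) :
    ((n : ℝ) + 1) ^ 2 ≤ eig k := by
  simp only [freqBox, Fintype.mem_piFinset, Finset.mem_Icc, not_forall] at hk
  obtain ⟨i, hi⟩ := hk
  have h1 : (n : ℤ) + 1 ≤ |k i| := by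
    rcases le_or_gt 0 (k i) with h | h
    · rw [abs_of_nonneg h]; omega
    · rw [abs_of_neg h]; omega
  have h2 : (n : ℝ) + 1 ≤ |(k i : ℝ)| := by exact_mod_cast h1
  have h3 : ((n : ℝ) + 1) ^ 2 ≤ (k i : ℝ) ^ 2 := by
    rw [← sq_abs (k i : ℝ)]
    exact pow_le_pow_left₀ (by positivity) h2 2
  have h4 : (k i : ℝ) ^ 2 ≤ freqSq k :=
    Finset.single_le_sum (f := fun i => (k i : ℝ) ^ 2) (fun _ _ => sq_nonneg _) (Finset.mem_univ i)
  have h5 : (1 : ℝ) ≤ 4 * Real.pi ^ 2 := by nlinarith [Real.pi_gt_three]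
  calc ((n : ℝ) + 1) ^ 2 ≤ freqSq k := h3.trans h4
    _ ≤ 4 * Real.pi ^ 2 * freqSq k := le_mul_of_one_le_left (freqSq_nonneg k) h5

/-- Let `P` be the part of `f` with frequencies in the box. Cauchy–Schwarz over its `(2n+1)^N`
frequencies gives `|P| ≤ r/2`, so `|f| > r` forces `|f - P| ≥ r/2`. Outside the box the eigenvalues
are at least `(n+1)²`, so `‖f - P‖² ≤ D/(n+1)²`, and Chebyshev's inequality concludes. -/
theorem measureReal_lt_abs_le_of_freqBox {f : Torus N → ℝ} (hf : MemLp f 2 (torusMeasure N))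
    {R D : ℝ} (hR : ∫ x, f x ^ 2 ∂torusMeasure N ≤ R ^ 2)
    (hD : ∀ s : Finset (Fin N → ℤ), ∑ k ∈ s, eig k * ‖torusCoeff f k‖ ^ 2 ≤ D) {n : ℕ} {r : ℝ}
    (hr : 0 < r) (hn : (2 * n + 1 : ℝ) ^ N * R ^ 2 ≤ (r / 2) ^ 2) :
    (torusMeasure N).real {x | r < |f x|} ≤ 4 / r ^ 2 * (D / ((n : ℝ) + 1) ^ 2) := by
  set P : Torus N → ℂ := fun x => ∑ k ∈ freqBox N n, torusCoeff f k * mFourier k x with hP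
  have hPc : Continuous P :=
    continuous_finsetSum _ fun k _ => continuous_const.mul (mFourier k).continuous
  have hPm : MemLp P 2 (torusMeasure N) := by
    obtain ⟨C, hC⟩ := isCompact_univ.exists_bound_of_continuousOn hPc.continuousOn
    exact MemLp.of_bound hPc.aestronglyMeasurable C (Eventually.of_forall fun x => hC x (mem_univ _))
  have hP1 : ∀ x, ‖P x‖ ≤ r / 2 := fun x => by
    have h1 : ‖P x‖ ≤ ∑ k ∈ freqBox N n, ‖torusCoeff f k‖ := by
      refine (norm_sum_le _ _).trans (Finset.sum_le_sum fun k _ => ?_)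
      rw [norm_mul, norm_mFourier_apply, mul_one]
    have h2 : (∑ k ∈ freqBox N n, ‖torusCoeff f k‖) ^ 2 ≤ (r / 2) ^ 2 := by
      refine sq_sum_le_card_mul_sum_sq.trans (le_trans ?_ hn)
      rw [card_freqBox]
      push_cast
      refine mul_le_mul_of_nonneg_left (le_trans ?_ hR) (by positivity)
      exact sum_le_hasSum _ (fun _ _ => by positivity) (hasSum_sq_norm_torusCoeff hf)
    exact h1.trans (le_of_sq_le_sq h2 (by positivity))
  have hfc : MemLp (fun x => (f x : ℂ)) 2 (torusMeasure N) := hf.ofReal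
  have hh : MemLp (fun x => (f x : ℂ) - P x) 2 (torusMeasure N) := hfc.sub hPm
  have hcoef : ∀ k, mFourierCoeff (fun x => (f x : ℂ) - P x) k
      = if k ∈ freqBox N n then 0 else torusCoeff f k := fun k => by
    rw [mFourierCoeff_sub (hfc.integrable (by norm_num)) (hPm.integrable (by norm_num))]
    have : mFourierCoeff P k = ∑ l ∈ freqBox N n, torusCoeff f l * (if k = l then 1 else 0) := by
      simp only [mFourierCoeff_eq, hP, Finset.mul_sum]
      rw [integral_finsetSum]
      · refine Finset.sum_congr rfl fun l _ => ?_
        rw [← mFourierCoeff_mFourier k l, mFourierCoeff_eq, ← integral_const_mul]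
        congr 1; funext x; ring
      · intro l _
        refine Continuous.integrable_of_hasCompactSupport ?_ (HasCompactSupport.of_compactSpace _)
        exact (mFourier (-k)).continuous.mul (continuous_const.mul (mFourier l).continuous)
    rw [this]
    change torusCoeff f k - _ = _
    simp only [mul_ite, mul_one, mul_zero, Finset.sum_ite_eq]
    split_ifs <;> simp
  have hint : ∫ x, ‖(f x : ℂ) - P x‖ ^ 2 ∂torusMeasure N ≤ D / ((n : ℝ) + 1) ^ 2 := by
    refine hasSum_le_of_sum_le (hasSum_sq_norm_mFourierCoeff hh) fun s => ?_
    rw [le_div_iff₀ (by positivity), Finset.sum_mul]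
    refine (Finset.sum_le_sum fun k _ => ?_).trans (hD s)
    rw [hcoef]
    split_ifs with h
    · simpa using mul_nonneg (eig_nonneg k) (sq_nonneg ‖torusCoeff f k‖)
    · rw [mul_comm]
      exact mul_le_mul_of_nonneg_right (le_eig_of_notMem_freqBox h) (by positivity)
  have hcheb := mul_meas_ge_le_integral_of_nonneg (μ := torusMeasure N)
    (f := fun x => ‖(f x : ℂ) - P x‖ ^ 2) (Eventually.of_forall fun x => by positivity)
    ((memLp_two_iff_integrable_sq_norm hh.1).1 hh) ((r / 2) ^ 2)
  have hsub : {x | r < |f x|} ⊆ {x | (r / 2) ^ 2 ≤ ‖(f x : ℂ) - P x‖ ^ 2} := fun x hx => by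
    have h1 : |f x| ≤ ‖(f x : ℂ) - P x‖ + ‖P x‖ := by
      have h2 := norm_add_le ((f x : ℂ) - P x) (P x)
      rwa [sub_add_cancel, Complex.norm_real, Real.norm_eq_abs] at h2
    have hx' : r < |f x| := hx
    have h3 : r / 2 ≤ ‖(f x : ℂ) - P x‖ := by linarith [hP1 x]
    exact pow_le_pow_left₀ (by positivity) h3 2
  have hm : (torusMeasure N).real {x | r < |f x|}
      ≤ (torusMeasure N).real {x | (r / 2) ^ 2 ≤ ‖(f x : ℂ) - P x‖ ^ 2} :=
    measureReal_mono hsub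
  have h3 : (r / 2) ^ 2 * (torusMeasure N).real {x | r < |f x|} ≤ D / ((n : ℝ) + 1) ^ 2 :=
    (mul_le_mul_of_nonneg_left hm (by positivity)).trans (hcheb.trans hint)
  calc (torusMeasure N).real {x | r < |f x|}
      = 4 / r ^ 2 * ((r / 2) ^ 2 * (torusMeasure N).real {x | r < |f x|}) := by field_simp; norm_num
    _ ≤ _ := mul_le_mul_of_nonneg_left h3 (by positivity)

/-- Functions in `H¹` belong to weak `L^{2+4/N}`. -/
theorem measureReal_lt_abs_le (hN : 1 ≤ N) {f : Torus N → ℝ} (hf : MemLp f 2 (torusMeasure N))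
    {R D : ℝ} (hR0 : 0 < R) (hR : ∫ x, f x ^ 2 ∂torusMeasure N ≤ R ^ 2) (hD0 : 0 ≤ D)
    (hD : ∀ s : Finset (Fin N → ℤ), ∑ k ∈ s, eig k * ‖torusCoeff f k‖ ^ 2 ≤ D) {r : ℝ}
    (hr : 2 * R ≤ r) :
    (torusMeasure N).real {x | r < |f x|}
      ≤ 36 * (2 * R) ^ (4 / (N : ℝ)) * D * r ^ (-2 - 4 / (N : ℝ)) := by
  have hN' : (0 : ℝ) < N := by exact_mod_cast hN
  have hr0 : 0 < r := by linarith
  set q := r / (2 * R) with hq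
  have hq1 : 1 ≤ q := by rw [hq, le_div_iff₀ (by positivity)]; linarith
  set y := q ^ (2 / (N : ℝ)) with hy
  have hy1 : 1 ≤ y := Real.one_le_rpow hq1 (by positivity)
  -- The largest box that the truncation lemma admits: `2n+1 ≤ y`, with `y` chosen so that `y^N R² =
  -- (r/2)²`. The assumption `2R ≤ r` makes `y ≥ 1`.
  set n := ⌊(y - 1) / 2⌋₊ with hn
  have hn1 : (n : ℝ) ≤ (y - 1) / 2 := Nat.floor_le (by linarith)
  have hn2 : (y - 1) / 2 < n + 1 := Nat.lt_floor_add_one _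
  have hn0 : (0 : ℝ) ≤ n := n.cast_nonneg
  have hyN : y ^ N = q ^ 2 := by
    rw [hy, ← Real.rpow_natCast, ← Real.rpow_mul (by linarith), div_mul_cancel₀ _ hN'.ne']
    norm_num
  have h1 : (2 * n + 1 : ℝ) ^ N * R ^ 2 ≤ (r / 2) ^ 2 := by
    calc (2 * n + 1 : ℝ) ^ N * R ^ 2 ≤ y ^ N * R ^ 2 := by
          gcongr; linarith
      _ = (r / 2) ^ 2 := by rw [hyN, hq]; field_simp
  refine (measureReal_lt_abs_le_of_freqBox hf hR hD hr0 h1).trans ?_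
  have h2 : D / ((n : ℝ) + 1) ^ 2 ≤ 9 * D * q ^ (-(4 / (N : ℝ))) := by
    -- From `y < 2n+3 ≤ 3(n+1)`; this 9 and the 4 from Chebyshev's inequality give the constant 36.
    have h3 : y ^ 2 ≤ 9 * ((n : ℝ) + 1) ^ 2 := by nlinarith
    have h4 : q ^ (-(4 / (N : ℝ))) = (y ^ 2)⁻¹ := by
      rw [Real.rpow_neg (by linarith), hy, ← Real.rpow_natCast, ← Real.rpow_mul (by linarith)]
      congr 2; push_cast; ring
    rw [h4, div_le_iff₀ (by positivity)]
    have h5 : 1 ≤ 9 * (y ^ 2)⁻¹ * ((n : ℝ) + 1) ^ 2 := by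
      rw [mul_comm (9 : ℝ), mul_assoc, ← div_eq_inv_mul, le_div_iff₀ (by positivity)]
      linarith
    nlinarith
  calc 4 / r ^ 2 * (D / ((n : ℝ) + 1) ^ 2) ≤ 4 / r ^ 2 * (9 * D * q ^ (-(4 / (N : ℝ)))) := by
        gcongr
    _ = _ := by
        rw [hq, Real.div_rpow hr0.le (by positivity), Real.rpow_sub hr0, Real.rpow_neg hr0.le,
          Real.rpow_neg hr0.le, Real.rpow_neg (by positivity)]
        rw [show r ^ (2 : ℝ) = r ^ 2 from Real.rpow_two r]
        field_simp
        ring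

/-- Layer-cake formula. Heights up to `2R` are bounded using total mass one; above `2R` the
weak-type bound leaves the power `t^e`, integrable at infinity exactly because `q < 2 + 4/N`. Only
the second contribution involves `D`, and linearly. -/
theorem exists_lintegral_rpow_le (hN : 1 ≤ N) {q : ℝ} (hq1 : 1 ≤ q) (hq2 : q < 2 + 4 / (N : ℝ))
    {R : ℝ} (hR0 : 0 < R) :
    ∃ C : ℝ, 0 ≤ C ∧ ∀ f : Torus N → ℝ, MemLp f 2 (torusMeasure N) →
      ∫ x, f x ^ 2 ∂torusMeasure N ≤ R ^ 2 → ∀ D : ℝ, 0 ≤ D →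
      (∀ s : Finset (Fin N → ℤ), ∑ k ∈ s, eig k * ‖torusCoeff f k‖ ^ 2 ≤ D) →
      ∫⁻ x, ENNReal.ofReal (|f x| ^ q) ∂torusMeasure N ≤ ENNReal.ofReal (C * (1 + D)) := by
  have hN' : (0 : ℝ) < N := by exact_mod_cast hN
  set K := 36 * (2 * R) ^ (4 / (N : ℝ)) with hK
  set e := (-2 - 4 / (N : ℝ)) + (q - 1) with he
  have he1 : e < -1 := by rw [he]; linarith
  have hint := integrableOn_Ioi_rpow_of_lt he1 (by positivity : 0 < 2 * R)
  set I := ∫ t in Ioi (2 * R), t ^ e with hI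
  have hI0 : 0 ≤ I := setIntegral_nonneg measurableSet_Ioi fun t ht =>
    Real.rpow_nonneg ((by positivity : 0 ≤ 2 * R).trans (mem_Ioi.1 ht).le) _
  have hK0 : 0 ≤ K := by positivity
  refine ⟨q * ((2 * R) ^ (q - 1) * (2 * R) + K * I), by positivity, fun f hf hfR D hD0 hD => ?_⟩
  have hf1 : AEMeasurable (fun x => |f x|) (torusMeasure N) :=
    hf.1.aemeasurable.abs
  rw [lintegral_rpow_eq_lintegral_meas_lt_mul (torusMeasure N)
    (Eventually.of_forall fun x => abs_nonneg (f x)) hf1 (by linarith : 0 < q),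
    ← Ioc_union_Ioi_eq_Ioi (by positivity : 0 ≤ 2 * R),
    lintegral_union measurableSet_Ioi (Ioc_disjoint_Ioi le_rfl)]
  have h1 : ∫⁻ t in Ioc 0 (2 * R), (torusMeasure N) {a | t < |f a|} * ENNReal.ofReal (t ^ (q - 1))
      ≤ ENNReal.ofReal ((2 * R) ^ (q - 1) * (2 * R)) := by
    calc _ ≤ ∫⁻ t in Ioc 0 (2 * R), ENNReal.ofReal ((2 * R) ^ (q - 1)) := by
          refine setLIntegral_mono' measurableSet_Ioc fun t ht => ?_
          refine (mul_le_of_le_one_left zero_le prob_le_one).trans ?_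
          exact ENNReal.ofReal_le_ofReal (Real.rpow_le_rpow ht.1.le ht.2 (by linarith))
      _ = _ := by
          rw [setLIntegral_const, Real.volume_Ioc, sub_zero, ← ENNReal.ofReal_mul (by positivity)]
  have h2 : ∫⁻ t in Ioi (2 * R), (torusMeasure N) {a | t < |f a|} * ENNReal.ofReal (t ^ (q - 1))
      ≤ ENNReal.ofReal (K * D * I) := by
    calc _ ≤ ∫⁻ t in Ioi (2 * R), ENNReal.ofReal (K * D * t ^ e) := by
          refine setLIntegral_mono' measurableSet_Ioi fun t ht => ?_
          have ht0 : 0 < t := (by positivity : 0 < 2 * R).trans ht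
          have hm := measureReal_lt_abs_le hN hf hR0 hfR hD0 hD (mem_Ioi.1 ht).le
          rw [← ofReal_measureReal, ← ENNReal.ofReal_mul measureReal_nonneg]
          refine ENNReal.ofReal_le_ofReal ?_
          rw [he, Real.rpow_add ht0, ← mul_assoc]
          exact mul_le_mul_of_nonneg_right hm (by positivity)
      _ = _ := by
          rw [hI, ← integral_const_mul, ofReal_integral_eq_lintegral_ofReal (hint.const_mul _)]
          filter_upwards [ae_restrict_mem measurableSet_Ioi] with t ht
          have ht0 : 0 < t := (by positivity : 0 < 2 * R).trans ht
          positivity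
  refine (mul_le_mul_right (add_le_add h1 h2) _).trans ?_
  rw [← ENNReal.ofReal_add (by positivity) (by positivity), ← ENNReal.ofReal_mul (by linarith : 0 ≤ q)]
  refine ENNReal.ofReal_le_ofReal ?_
  rw [mul_assoc q]
  refine mul_le_mul_of_nonneg_left ?_ (by linarith)
  have h3 : 0 ≤ (2 * R) ^ (q - 1) * (2 * R) := by positivity
  have h4 : 0 ≤ K * I := by positivity
  nlinarith [mul_nonneg h3 hD0]

/-- Gagliardo–Nirenberg: the power `|f|^p` of an `H¹` function is square integrable for
`p < 1 + 2/N`, with a norm that grows at most linearly in `∇f`. -/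
theorem exists_memLp_absRpow (hN : 1 ≤ N) {p : ℝ} (hp1 : 1 ≤ p) (hp2 : p < 1 + 2 / (N : ℝ))
    {R : ℝ} (hR0 : 0 < R) :
    ∃ C : ℝ, 0 ≤ C ∧ ∀ f : Torus N → ℝ, MemLp f 2 (torusMeasure N) →
      ∫ x, f x ^ 2 ∂torusMeasure N ≤ R ^ 2 → ∀ D : ℝ, 0 ≤ D →
      (∀ s : Finset (Fin N → ℤ), ∑ k ∈ s, eig k * ‖torusCoeff f k‖ ^ 2 ≤ D) →
      MemLp (fun x => |f x| ^ p) 2 (torusMeasure N) ∧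
        ∫ x, (|f x| ^ p) ^ 2 ∂torusMeasure N ≤ C * (1 + D) := by
  -- `‖|f|^p‖²` is the integral of `|f|^{2p}`, and the strict inequality for `p` puts `2p` strictly
  -- below the weak-type exponent.
  obtain ⟨C, hC0, hC⟩ := exists_lintegral_rpow_le hN (q := 2 * p) (by linarith)
    (by rw [show (4 : ℝ) / N = 2 * (2 / N) by ring]; linarith) hR0
  refine ⟨C, hC0, fun f hf hfR D hD0 hD => ?_⟩
  have h := hC f hf hfR D hD0 hD
  have hpow : ∀ x, (|f x| ^ p) ^ 2 = |f x| ^ (2 * p) := fun x => by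
    rw [← Real.rpow_natCast, ← Real.rpow_mul (abs_nonneg _), mul_comm]; norm_num
  have hm : AEStronglyMeasurable (fun x => |f x| ^ p) (torusMeasure N) :=
    (hf.1.aemeasurable.abs.pow_const p).aestronglyMeasurable
  have hm2 : AEStronglyMeasurable (fun x => (|f x| ^ p) ^ 2) (torusMeasure N) := hm.pow 2
  have hlt : ∫⁻ x, ENNReal.ofReal ((|f x| ^ p) ^ 2) ∂torusMeasure N
      ≤ ENNReal.ofReal (C * (1 + D)) := by simpa only [hpow] using h
  refine ⟨(memLp_two_iff_integrable_sq hm).2 ⟨hm2, ?_⟩, ?_⟩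
  · rw [hasFiniteIntegral_iff_ofReal (Eventually.of_forall fun x => by positivity)]
    exact hlt.trans_lt ENNReal.ofReal_lt_top
  · rw [integral_eq_lintegral_of_nonneg_ae (Eventually.of_forall fun x => by positivity) hm2]
    exact ENNReal.toReal_le_of_le_ofReal (by positivity) hlt

/-! ### Parseval's identity in space and time -/

/-- `f ∈ L²(ν; L²(𝕋ᴺ))`, measurability being expressed through the Fourier coefficients. -/
structure SqIntegrable (ν : Measure ℝ) (f : ℝ → Torus N → ℝ) : Prop where
  memLp : ∀ᵐ τ ∂ν, MemLp (f τ) 2 (torusMeasure N)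
  meas : ∀ k, AEStronglyMeasurable (fun τ => torusCoeff (f τ) k) ν
  integrable_sq : Integrable (fun τ => ∫ x, f τ x ^ 2 ∂torusMeasure N) ν

section SqIntegrable

variable {ν ν' : Measure ℝ} {f g : ℝ → Torus N → ℝ}

/-- Parseval writes the spatial pairing as a limit of finite sums of measurable coefficients, so
joint measurability in time and space is never needed. -/
theorem aestronglyMeasurable_integral_mul (hf : ∀ᵐ τ ∂ν, MemLp (f τ) 2 (torusMeasure N))
    (hf' : ∀ k, AEStronglyMeasurable (fun τ => torusCoeff (f τ) k) ν)
    (hg : ∀ᵐ τ ∂ν, MemLp (g τ) 2 (torusMeasure N))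
    (hg' : ∀ k, AEStronglyMeasurable (fun τ => torusCoeff (g τ) k) ν) :
    AEStronglyMeasurable (fun τ => ∫ x, f τ x * g τ x ∂torusMeasure N) ν := by
  have h : AEStronglyMeasurable
      (fun τ => ((∫ x, f τ x * g τ x ∂torusMeasure N : ℝ) : ℂ)) ν := by
    refine aestronglyMeasurable_of_tendsto_ae atTop
      (f := fun (s : Finset (Fin N → ℤ)) τ =>
        ∑ k ∈ s, torusCoeff (f τ) k * conj (torusCoeff (g τ) k)) (fun s => ?_) ?_
    · exact Finset.aestronglyMeasurable_fun_sum s fun k _ =>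
        (hf' k).mul (Complex.continuous_conj.comp_aestronglyMeasurable (hg' k))
    · filter_upwards [hf, hg] with τ h1 h2
      exact hasSum_torusCoeff_mul h1 h2
  simpa using Complex.continuous_re.comp_aestronglyMeasurable h

/-- Young's inequality with a free weight `c`, which later absorbs the forcing into the dissipation.
-/
theorem integral_mul_le_sq_add_sq {a b : Torus N → ℝ} (ha : MemLp a 2 (torusMeasure N))
    (hb : MemLp b 2 (torusMeasure N)) {c : ℝ} (hc : 0 < c) :
    2 * |∫ x, a x * b x ∂torusMeasure N|
      ≤ c * (∫ x, a x ^ 2 ∂torusMeasure N) + c⁻¹ * ∫ x, b x ^ 2 ∂torusMeasure N := by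
  rw [← integral_const_mul c, ← integral_const_mul c⁻¹,
    ← integral_add (ha.integrable_sq.const_mul c) (hb.integrable_sq.const_mul c⁻¹)]
  have h1 : 2 * |∫ x, a x * b x ∂torusMeasure N| ≤ 2 * ∫ x, |a x * b x| ∂torusMeasure N :=
    mul_le_mul_of_nonneg_left abs_integral_le_integral_abs (by norm_num)
  refine h1.trans ?_
  rw [← integral_const_mul]
  refine integral_mono ((ha.integrable_mul hb).abs.const_mul 2)
    ((ha.integrable_sq.const_mul c).add (hb.integrable_sq.const_mul c⁻¹)) fun x => ?_
  have h2 : 0 ≤ c⁻¹ * (c * |a x| - |b x|) ^ 2 := by positivity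
  have h3 : c⁻¹ * (c * |a x| - |b x|) ^ 2
      = c * a x ^ 2 + c⁻¹ * b x ^ 2 - 2 * |a x * b x| := by
    rw [abs_mul, ← sq_abs (a x), ← sq_abs (b x)]
    field_simp; ring
  simp only
  linarith

namespace SqIntegrable

/-- Measurability of the spatial norm follows from that of the coefficients, so an integrable
majorant is enough. -/
theorem of_bound (h1 : ∀ᵐ τ ∂ν, MemLp (f τ) 2 (torusMeasure N))
    (h2 : ∀ k, AEStronglyMeasurable (fun τ => torusCoeff (f τ) k) ν) {h : ℝ → ℝ}
    (hi : Integrable h ν) (hb : ∀ᵐ τ ∂ν, ∫ x, f τ x ^ 2 ∂torusMeasure N ≤ h τ) :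
    SqIntegrable ν f := by
  refine ⟨h1, h2, hi.mono' ?_ ?_⟩
  · simpa only [pow_two] using aestronglyMeasurable_integral_mul h1 h2 h1 h2
  · filter_upwards [hb] with τ hτ
    rwa [Real.norm_of_nonneg (integral_nonneg fun x => sq_nonneg _)]

theorem mono_measure (hf : SqIntegrable ν f) (h : ν' ≤ ν) : SqIntegrable ν' f :=
  ⟨ae_mono h hf.memLp, fun k => (hf.meas k).mono_measure h, hf.integrable_sq.mono_measure h⟩

theorem integrable_integral_mul (hf : SqIntegrable ν f) (hg : SqIntegrable ν g) :
    Integrable (fun τ => ∫ x, f τ x * g τ x ∂torusMeasure N) ν := by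
  refine (hf.integrable_sq.add hg.integrable_sq).mono'
    (aestronglyMeasurable_integral_mul hf.memLp hf.meas hg.memLp hg.meas) ?_
  filter_upwards [hf.memLp, hg.memLp] with τ h1 h2
  have h := integral_mul_le_sq_add_sq h1 h2 one_pos
  simp only [one_mul, inv_one] at h
  rw [Real.norm_eq_abs, Pi.add_apply]
  linarith [abs_nonneg (∫ x, f τ x * g τ x ∂torusMeasure N)]

theorem integrable_sq_norm_coeff (hf : SqIntegrable ν f) (k : Fin N → ℤ) :
    Integrable (fun τ => ‖torusCoeff (f τ) k‖ ^ 2) ν := by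
  refine hf.integrable_sq.mono' ((hf.meas k).norm.pow 2) ?_
  filter_upwards [hf.memLp] with τ h1
  rw [Real.norm_of_nonneg (by positivity)]
  exact sq_norm_torusCoeff_le h1 k

theorem summable_integral_sq_norm_coeff (hf : SqIntegrable ν f) :
    Summable fun k => ∫ τ, ‖torusCoeff (f τ) k‖ ^ 2 ∂ν := by
  refine summable_of_sum_le (c := ∫ τ, ∫ x, f τ x ^ 2 ∂torusMeasure N ∂ν)
    (fun k => integral_nonneg fun τ => by positivity) fun s => ?_
  rw [← integral_finsetSum _ fun k _ => hf.integrable_sq_norm_coeff k]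
  refine integral_mono_ae (integrable_finsetSum _ fun k _ => hf.integrable_sq_norm_coeff k)
    hf.integrable_sq ?_
  filter_upwards [hf.memLp] with τ h1
  exact sum_le_hasSum _ (fun _ _ => by positivity) (hasSum_sq_norm_torusCoeff h1)

theorem norm_coeff_mul_le (f g : ℝ → Torus N → ℝ) (k : Fin N → ℤ) (τ : ℝ) :
    ‖torusCoeff (f τ) k * conj (torusCoeff (g τ) k)‖
      ≤ ‖torusCoeff (f τ) k‖ ^ 2 + ‖torusCoeff (g τ) k‖ ^ 2 := by
  rw [norm_mul, RCLike.norm_conj]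
  nlinarith [sq_nonneg (‖torusCoeff (f τ) k‖ - ‖torusCoeff (g τ) k‖),
    sq_nonneg (‖torusCoeff (f τ) k‖), sq_nonneg (‖torusCoeff (g τ) k‖)]

theorem integrable_coeff_mul (hf : SqIntegrable ν f) (hg : SqIntegrable ν g) (k : Fin N → ℤ) :
    Integrable (fun τ => torusCoeff (f τ) k * conj (torusCoeff (g τ) k)) ν :=
  ((hf.integrable_sq_norm_coeff k).add (hg.integrable_sq_norm_coeff k)).mono'
    ((hf.meas k).mul (Complex.continuous_conj.comp_aestronglyMeasurable (hg.meas k)))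
    (Eventually.of_forall (norm_coeff_mul_le f g k))

/-- Parseval's identity in `L²(ν; L²(𝕋ᴺ))`. -/
theorem hasSum_integral_coeff_mul (hf : SqIntegrable ν f) (hg : SqIntegrable ν g) :
    HasSum (fun k => ∫ τ, torusCoeff (f τ) k * conj (torusCoeff (g τ) k) ∂ν)
      ((∫ τ, ∫ x, f τ x * g τ x ∂torusMeasure N ∂ν : ℝ) : ℂ) := by
  -- Sum and time integral are exchanged by the termwise bound `|ab| ≤ |a|² + |b|²`, whose time
  -- integrals are summable over the modes.
  have h := hasSum_integral_of_summable_integral_norm (μ := ν)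
    (F := fun k τ => torusCoeff (f τ) k * conj (torusCoeff (g τ) k))
    (fun k => hf.integrable_coeff_mul hg k) (by
      refine Summable.of_nonneg_of_le (fun k => integral_nonneg fun τ => norm_nonneg _)
        (fun k => ?_) (hf.summable_integral_sq_norm_coeff.add hg.summable_integral_sq_norm_coeff)
      rw [← integral_add (hf.integrable_sq_norm_coeff k) (hg.integrable_sq_norm_coeff k)]
      exact integral_mono (hf.integrable_coeff_mul hg k).norm
        ((hf.integrable_sq_norm_coeff k).add (hg.integrable_sq_norm_coeff k))
        (norm_coeff_mul_le f g k))
  have h2 : ((∫ τ, ∫ x, f τ x * g τ x ∂torusMeasure N ∂ν : ℝ) : ℂ)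
      = ∫ τ, ∑' k, torusCoeff (f τ) k * conj (torusCoeff (g τ) k) ∂ν := by
    rw [← integral_complex_ofReal]
    refine integral_congr_ae ?_
    filter_upwards [hf.memLp, hg.memLp] with τ h1 h2
    exact (hasSum_torusCoeff_mul h1 h2).tsum_eq.symm
  rw [h2]
  exact h

end SqIntegrable

theorem integral_norm_le_norm {E : Type*} [NormedAddCommGroup E]
    (F : Lp E 2 (torusMeasure N)) : ∫ x, ‖F x‖ ∂torusMeasure N ≤ ‖F‖ := by
  rw [integral_norm_eq_lintegral_enorm (Lp.aestronglyMeasurable F), Lp.norm_def,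
    ← eLpNorm_one_eq_lintegral_enorm]
  exact ENNReal.toReal_mono (Lp.eLpNorm_ne_top F)
    (eLpNorm_le_eLpNorm_of_exponent_le (by norm_num) (Lp.aestronglyMeasurable F))

theorem continuous_integral_norm :
    Continuous fun F : Lp ℂ 2 (torusMeasure N) => ∫ x, ‖F x‖ ∂torusMeasure N := by
  have hi : ∀ F : Lp ℂ 2 (torusMeasure N), Integrable F (torusMeasure N) := fun F =>
    (Lp.memLp F).integrable (by norm_num)
  have key : ∀ F G : Lp ℂ 2 (torusMeasure N),
      ∫ x, ‖F x‖ ∂torusMeasure N ≤ ∫ x, ‖G x‖ ∂torusMeasure N + 1 * dist F G := fun F G => by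
    rw [one_mul, dist_eq_norm]
    refine le_trans ?_ (add_le_add_right (integral_norm_le_norm (F - G)) _)
    rw [← integral_add (hi G).norm (hi (F - G)).norm]
    refine integral_mono_ae (hi F).norm ((hi G).norm.add (hi (F - G)).norm) ?_
    filter_upwards [Lp.coeFn_sub F G] with x hx
    rw [hx]
    simpa using norm_add_le (G x) (F x - G x)
  exact (LipschitzWith.of_le_add_mul 1 key).continuous

/-- The `L¹` norm is not a pairing, so measurability comes from partial Fourier sums, which converge
in `L²`, where the `L¹` norm is continuous. -/
theorem SqIntegrable.integrable_integral_abs [IsFiniteMeasure ν] (hf : SqIntegrable ν f) :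
    Integrable (fun τ => ∫ x, |f τ x| ∂torusMeasure N) ν := by
  have hm : AEStronglyMeasurable (fun τ => ∫ x, |f τ x| ∂torusMeasure N) ν := by
    refine aestronglyMeasurable_of_tendsto_ae atTop
      (f := fun (s : Finset (Fin N → ℤ)) τ => ∫ x, ‖(∑ k ∈ s, torusCoeff (f τ) k •
        ContinuousMap.toLp (E := ℂ) 2 (torusMeasure N) ℂ (mFourier k) :
          Lp ℂ 2 (torusMeasure N)) x‖ ∂torusMeasure N) (fun s => ?_) ?_
    · exact continuous_integral_norm.comp_aestronglyMeasurable
        (Finset.aestronglyMeasurable_fun_sum s fun k _ => (hf.meas k).smul_const _)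
    · filter_upwards [hf.memLp] with τ h1
      have h2 : MemLp (fun x => (f τ x : ℂ)) 2 (torusMeasure N) := h1.ofReal
      have h3 := hasSum_mFourier_series_L2 h2.toLp
      simp only [mFourierCoeff_congr_ae h2.coeFn_toLp] at h3
      have h4 := (continuous_integral_norm.tendsto h2.toLp).comp h3
      have h5 : ∫ x, ‖h2.toLp (fun x => (f τ x : ℂ)) x‖ ∂torusMeasure N = ∫ x, |f τ x| ∂torusMeasure N := by
        refine integral_congr_ae ?_
        filter_upwards [h2.coeFn_toLp] with x hx
        rw [hx, Complex.norm_real, Real.norm_eq_abs]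
      rw [h5] at h4
      exact h4
  refine ((integrable_const (1 : ℝ)).add hf.integrable_sq).mono' hm ?_
  filter_upwards [hf.memLp] with τ h1
  rw [Real.norm_of_nonneg (integral_nonneg fun x => abs_nonneg _), Pi.add_apply]
  have h2 : (1 : ℝ) = ∫ _ : Torus N, (1 : ℝ) ∂torusMeasure N := by simp
  nth_rewrite 2 [h2]
  rw [← integral_add (integrable_const _) h1.integrable_sq]
  refine integral_mono (h1.integrable (by norm_num)).abs
    ((integrable_const _).add h1.integrable_sq) fun x => ?_
  simp only
  nlinarith [sq_nonneg (|f τ x| - 1), sq_abs (f τ x), sq_nonneg (f τ x)]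

end SqIntegrable

/-! ### Heat flows: pairing, energy identity and dissipation -/

theorem HasL2Grad.torusCoeff_weakGrad {f : L2 N} (h : HasL2Grad f) (k : Fin N → ℤ) (i : Fin N) :
    torusCoeff (fun x => weakGrad f x i) k = 2 * Real.pi * Complex.I * k i * torusCoeff f k :=
  (weakGrad_spec h).torusCoeff_apply (memLp_coe f) (Lp.memLp _) k i

theorem memLp_weakGrad_apply (f : L2 N) (i : Fin N) :
    MemLp (fun x => weakGrad f x i) 2 (torusMeasure N) := memLp_apply (Lp.memLp _) i

theorem integral_sq_norm_weakGrad (f : L2 N) :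
    ∫ x, ‖weakGrad f x‖ ^ 2 ∂torusMeasure N
      = ∑ i, ∫ x, weakGrad f x i ^ 2 ∂torusMeasure N := by
  rw [← integral_finsetSum _ fun i _ => (memLp_weakGrad_apply f i).integrable_sq]
  simp only [EuclideanSpace.real_norm_sq_eq]

theorem integral_sq_norm_weakGrad_eq_norm_sq (f : L2 N) :
    ∫ x, ‖weakGrad f x‖ ^ 2 ∂torusMeasure N = ‖weakGrad f‖ ^ 2 := by
  rw [← real_inner_self_eq_norm_sq, L2.inner_def]
  simp

/-- The polarised symbol of `-Δ`; it exchanges the eigenvalue in the scalar equations for the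
Dirichlet form. -/
theorem sum_grad_coeff_mul (k : Fin N → ℤ) (a b : ℂ) :
    ∑ i, (2 * Real.pi * Complex.I * k i * a) * conj (2 * Real.pi * Complex.I * k i * b)
      = eig k * (a * conj b) := by
  simp only [eig, freqSq, map_mul, Complex.conj_I, Complex.conj_ofReal, map_ofNat, map_intCast]
  push_cast
  rw [Finset.mul_sum, Finset.sum_mul]
  refine Finset.sum_congr rfl fun i _ => ?_
  linear_combination (-4 * (Real.pi : ℂ) ^ 2 * (k i) ^ 2 * a * conj b) * Complex.I_sq

theorem HasL2Grad.hasSum_eig {f : L2 N} (h : HasL2Grad f) :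
    HasSum (fun k => eig k * ‖torusCoeff f k‖ ^ 2) (∫ x, ‖weakGrad f x‖ ^ 2 ∂torusMeasure N) := by
  rw [integral_sq_norm_weakGrad]
  convert hasSum_sum fun i (_ : i ∈ Finset.univ) =>
    hasSum_sq_norm_torusCoeff (memLp_weakGrad_apply f i) using 1
  funext k
  apply Complex.ofReal_injective
  have h1 := sum_grad_coeff_mul k (torusCoeff f k) (torusCoeff f k)
  rw [Complex.mul_conj'] at h1
  push_cast
  rw [← h1]
  refine Finset.sum_congr rfl fun i _ => ?_
  rw [h.torusCoeff_weakGrad, Complex.mul_conj']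

/-- `u` solves `u_t = Δu + F` on `[0,T]`, the equation being integrated in time for each
Fourier mode. -/
structure IsHeatFlow (T : ℝ) (u : ℝ → L2 N) (F : ℝ → Torus N → ℝ) : Prop where
  cont : ContinuousOn u (Icc 0 T)
  hasL2Grad : ∀ t ∈ Ioc 0 T, HasL2Grad (u t)
  intervalIntegrable : ∀ k, IntervalIntegrable (fun τ => torusCoeff (F τ) k) volume 0 T
  ode : ∀ k, ∀ t ∈ Icc 0 T, torusCoeff (u t) k = torusCoeff (u 0) k
    + ∫ τ in (0 : ℝ)..t, (-eig k * torusCoeff (u τ) k + torusCoeff (F τ) k)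

namespace IsHeatFlow

variable {T s t : ℝ} {u : ℝ → L2 N} {F : ℝ → Torus N → ℝ}

theorem continuousOn_coeff (h : IsHeatFlow T u F) (k : Fin N → ℤ) :
    ContinuousOn (fun τ => torusCoeff (u τ) k) (Icc 0 T) :=
  (coeffCLM k).continuous.comp_continuousOn h.cont

theorem intervalIntegrable_rhs (h : IsHeatFlow T u F) (hs : 0 ≤ s) (hst : s ≤ t) (ht : t ≤ T)
    (k : Fin N → ℤ) :
    IntervalIntegrable (fun τ => -eig k * torusCoeff (u τ) k + torusCoeff (F τ) k)
      volume s t := by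
  have hsub : uIcc s t ⊆ Icc 0 T := by rw [uIcc_of_le hst]; exact Icc_subset_Icc hs ht
  refine IntervalIntegrable.add ?_ ?_
  · exact (continuousOn_const.mul ((h.continuousOn_coeff k).mono hsub)).intervalIntegrable
  · refine (h.intervalIntegrable k).mono_set ?_
    rwa [uIcc_of_le ((hs.trans hst).trans ht)]

theorem ode_from (h : IsHeatFlow T u F) (hs : 0 ≤ s) {τ : ℝ} (hst : s ≤ τ) (ht : τ ≤ T)
    (k : Fin N → ℤ) :
    torusCoeff (u τ) k = torusCoeff (u s) k
      + ∫ r in s..τ, (-eig k * torusCoeff (u r) k + torusCoeff (F r) k) := by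
  rw [h.ode k τ ⟨hs.trans hst, ht⟩, h.ode k s ⟨hs, hst.trans ht⟩, add_assoc,
    intervalIntegral.integral_add_adjacent_intervals
      (h.intervalIntegrable_rhs le_rfl hs (hst.trans ht) k) (h.intervalIntegrable_rhs hs hst ht k)]

theorem sqIntegrable (h : IsHeatFlow T u F) (hs : 0 ≤ s) (ht : t ≤ T) :
    SqIntegrable (volume.restrict (Ioc s t)) fun τ => u τ := by
  have hsub : Icc s t ⊆ Icc 0 T := Icc_subset_Icc hs ht
  refine ⟨Eventually.of_forall fun τ => memLp_coe _, fun k => ?_, ?_⟩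
  · exact (((h.continuousOn_coeff k).mono hsub).aestronglyMeasurable measurableSet_Icc).mono_measure
      (Measure.restrict_mono Ioc_subset_Icc_self le_rfl)
  · simp only [integral_sq_eq_norm_sq]
    exact (((h.cont.mono hsub).norm.pow 2).integrableOn_compact isCompact_Icc).mono_set
      Ioc_subset_Icc_self

/-- The majorant `D` is left free because two are used: a constant on `(s,T]` with `s > 0`, and
later the dissipation itself on `(0,T]`. -/
theorem sqIntegrable_grad (h : IsHeatFlow T u F) (hs : 0 ≤ s) (ht : t ≤ T) {D : ℝ → ℝ}
    (hD : IntegrableOn D (Ioc s t))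
    (hDle : ∀ τ ∈ Ioc s t, ∫ x, ‖weakGrad (u τ) x‖ ^ 2 ∂torusMeasure N ≤ D τ) (i : Fin N) :
    SqIntegrable (volume.restrict (Ioc s t)) fun τ x => weakGrad (u τ) x i := by
  refine SqIntegrable.of_bound (Eventually.of_forall fun τ => memLp_weakGrad_apply _ i)
    (fun k => ?_) hD ?_
  · refine (((h.sqIntegrable hs ht).meas k).const_mul (2 * Real.pi * Complex.I * k i)).congr ?_
    filter_upwards [ae_restrict_mem measurableSet_Ioc] with τ hτ
    exact ((h.hasL2Grad τ ⟨hs.trans_lt hτ.1, hτ.2.trans ht⟩).torusCoeff_weakGrad k i).symm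
  · filter_upwards [ae_restrict_mem measurableSet_Ioc] with τ hτ
    refine le_trans ?_ (hDle τ hτ)
    rw [integral_sq_norm_weakGrad]
    exact Finset.single_le_sum (f := fun i => ∫ x, weakGrad (u τ) x i ^ 2 ∂torusMeasure N)
      (fun _ _ => integral_nonneg fun _ => sq_nonneg _) (Finset.mem_univ i)

/-- The evolution of the pairing of a heat flow with a time dependent function. -/
theorem integral_mul_sub (h : IsHeatFlow T u F) (hs : 0 ≤ s) (hst : s ≤ t) (ht : t ≤ T)
    (hF : SqIntegrable (volume.restrict (Ioc s t)) F)
    (hG : ∀ i, SqIntegrable (volume.restrict (Ioc s t)) fun τ x => weakGrad (u τ) x i)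
    {w : ℝ → Torus N → ℝ} {W : Fin N → ℝ → Torus N → ℝ} {β : (Fin N → ℤ) → ℝ → ℂ} {X : ℂ}
    (hw : SqIntegrable (volume.restrict (Ioc s t)) w)
    (hW : ∀ i, SqIntegrable (volume.restrict (Ioc s t)) (W i))
    (hWc : ∀ τ ∈ Ioc s t, ∀ k i,
      torusCoeff (W i τ) k = 2 * Real.pi * Complex.I * k i * torusCoeff (w τ) k)
    (hws : MemLp (w s) 2 (torusMeasure N)) (hwt : MemLp (w t) 2 (torusMeasure N))
    (hβ : ∀ k, IntervalIntegrable (β k) volume s t)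
    (hode : ∀ k, ∀ τ ∈ Icc s t, torusCoeff (w τ) k = torusCoeff (w s) k + ∫ r in s..τ, β k r)
    (hX : HasSum (fun k => ∫ τ in s..t, torusCoeff (u τ) k * conj (β k τ)) X) :
    ((∫ x, u t x * w t x ∂torusMeasure N : ℝ) : ℂ) - (∫ x, u s x * w s x ∂torusMeasure N : ℝ)
      = -(∑ i, ((∫ τ in s..t, ∫ x, weakGrad (u τ) x i * W i τ x ∂torusMeasure N : ℝ) : ℂ))
        + (∫ τ in s..t, ∫ x, F τ x * w τ x ∂torusMeasure N : ℝ) + X := by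
  -- Both sides are series over `k`, so the identity reduces to the scalar product rule for each
  -- mode. The last term enters through `hX`, because `β` need not be square integrable in space:
  -- for `w = u` it represents `Δu + F`.
  have hL := (hasSum_torusCoeff_mul (memLp_coe (u t)) hwt).sub
    (hasSum_torusCoeff_mul (memLp_coe (u s)) hws)
  have hsumG := hasSum_sum fun i (_ : i ∈ Finset.univ) => (hG i).hasSum_integral_coeff_mul (hW i)
  have hR := (hsumG.neg.add (hF.hasSum_integral_coeff_mul hw)).add hX
  simp only [intervalIntegral.integral_of_le hst] at hR ⊢
  refine hL.unique ?_
  convert hR using 1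
  funext k
  have hsub : uIcc s t ⊆ Icc 0 T := by rw [uIcc_of_le hst]; exact Icc_subset_Icc hs ht
  have hconj : ∀ τ ∈ Icc s t, conj (torusCoeff (w τ) k)
      = conj (torusCoeff (w s) k) + ∫ r in s..τ, conj (β k r) := fun τ hτ => by
    rw [hode k τ hτ, map_add, intervalIntegral.integral_of_le hτ.1,
      intervalIntegral.integral_of_le hτ.1, integral_conj]
  have hβc : IntervalIntegrable (fun τ => conj (β k τ)) volume s t := by
    rw [intervalIntegrable_iff_integrableOn_Ioc_of_le hst]
    exact (Complex.conjLIE.integrable_comp_iff).2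
      ((intervalIntegrable_iff_integrableOn_Ioc_of_le hst).1 (hβ k))
  have hp := mul_sub_mul_eq_integral (a := fun τ => torusCoeff (u τ) k)
    (b := fun τ => conj (torusCoeff (w τ) k)) hst (h.intervalIntegrable_rhs hs hst ht k) hβc
    (fun τ hτ => h.ode_from hs hτ.1 (hτ.2.trans ht) k) hconj
  rw [hp, intervalIntegral.integral_of_le hst]
  have hi1 : ∀ i, Integrable (fun τ => torusCoeff (fun x => weakGrad (u τ) x i) k
      * conj (torusCoeff (W i τ) k)) (volume.restrict (Ioc s t)) := fun i =>
    (hG i).integrable_coeff_mul (hW i) k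
  have hi2 := hF.integrable_coeff_mul hw k
  have hi3 : Integrable (fun τ => torusCoeff (u τ) k * conj (β k τ))
      (volume.restrict (Ioc s t)) :=
    (intervalIntegrable_iff_integrableOn_Ioc_of_le hst).1
      (hβc.continuousOn_mul ((h.continuousOn_coeff k).mono hsub))
  have hi0 : Integrable (fun τ => -∑ i, torusCoeff (fun x => weakGrad (u τ) x i) k
      * conj (torusCoeff (W i τ) k)) (volume.restrict (Ioc s t)) :=
    (integrable_finsetSum _ fun i _ => hi1 i).neg
  rw [← integral_finsetSum _ fun i _ => hi1 i, ← integral_neg,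
    ← integral_add hi0 hi2, ← integral_add _ hi3]
  · refine setIntegral_congr_fun measurableSet_Ioc fun τ hτ => ?_
    have h1 : ∑ i, torusCoeff (fun x => weakGrad (u τ) x i) k * conj (torusCoeff (W i τ) k)
        = eig k * (torusCoeff (u τ) k * conj (torusCoeff (w τ) k)) := by
      rw [← sum_grad_coeff_mul]
      refine Finset.sum_congr rfl fun i _ => ?_
      rw [(h.hasL2Grad τ ⟨hs.trans_lt hτ.1, hτ.2.trans ht⟩).torusCoeff_weakGrad, hWc τ hτ]
    simp only
    rw [h1]; ring
  · exact hi0.add hi2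

theorem integrable_sq_norm_grad
    (hG : ∀ i, SqIntegrable (volume.restrict (Ioc s t)) fun τ x => weakGrad (u τ) x i) :
    IntegrableOn (fun τ => ∫ x, ‖weakGrad (u τ) x‖ ^ 2 ∂torusMeasure N) (Ioc s t) := by
  simp only [integral_sq_norm_weakGrad]
  exact integrable_finsetSum _ fun i _ => (hG i).integrable_sq

theorem integral_sq_norm_grad (hst : s ≤ t)
    (hG : ∀ i, SqIntegrable (volume.restrict (Ioc s t)) fun τ x => weakGrad (u τ) x i) :
    ∫ τ in s..t, ∫ x, ‖weakGrad (u τ) x‖ ^ 2 ∂torusMeasure N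
      = ∑ i, ∫ τ in s..t, ∫ x, weakGrad (u τ) x i * weakGrad (u τ) x i ∂torusMeasure N := by
  simp only [integral_sq_norm_weakGrad, intervalIntegral.integral_of_le hst]
  simp only [pow_two]
  rw [integral_finsetSum]
  intro i _
  simpa only [pow_two] using (hG i).integrable_sq

/-- The energy identity of a heat flow. -/
theorem energy (h : IsHeatFlow T u F) (hs : 0 ≤ s) (hst : s ≤ t) (ht : t ≤ T)
    (hF : SqIntegrable (volume.restrict (Ioc s t)) F)
    (hG : ∀ i, SqIntegrable (volume.restrict (Ioc s t)) fun τ x => weakGrad (u τ) x i) :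
    ‖u t‖ ^ 2 - ‖u s‖ ^ 2
      = -2 * (∫ τ in s..t, ∫ x, ‖weakGrad (u τ) x‖ ^ 2 ∂torusMeasure N)
        + 2 * ∫ τ in s..t, ∫ x, F τ x * u τ x ∂torusMeasure N := by
  have hu := h.sqIntegrable hs ht
  -- For `w = u` the contribution of `conj β` is again minus the Dirichlet form plus the pairing
  -- with `F`, whence the factors 2 below.
  have hX : HasSum (fun k => ∫ τ in s..t, torusCoeff (u τ) k *
      conj (-eig k * torusCoeff (u τ) k + torusCoeff (F τ) k))
      (-(∑ i, ((∫ τ in s..t, ∫ x, weakGrad (u τ) x i * weakGrad (u τ) x i ∂torusMeasure N : ℝ) : ℂ))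
        + (∫ τ in s..t, ∫ x, u τ x * F τ x ∂torusMeasure N : ℝ)) := by
    have hsumG := hasSum_sum fun i (_ : i ∈ Finset.univ) =>
      (hG i).hasSum_integral_coeff_mul (hG i)
    have hR := hsumG.neg.add (hu.hasSum_integral_coeff_mul hF)
    simp only [intervalIntegral.integral_of_le hst]
    refine hR.congr_fun fun k => ?_
    have hi1 : ∀ i, Integrable (fun τ => torusCoeff (fun x => weakGrad (u τ) x i) k
        * conj (torusCoeff (fun x => weakGrad (u τ) x i) k)) (volume.restrict (Ioc s t)) :=
      fun i => (hG i).integrable_coeff_mul (hG i) k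
    have hi0 : Integrable (fun τ => -∑ i, torusCoeff (fun x => weakGrad (u τ) x i) k
        * conj (torusCoeff (fun x => weakGrad (u τ) x i) k)) (volume.restrict (Ioc s t)) :=
      (integrable_finsetSum _ fun i _ => hi1 i).neg
    rw [← integral_finsetSum _ fun i _ => hi1 i, ← integral_neg,
      ← integral_add hi0 (hu.integrable_coeff_mul hF k)]
    refine setIntegral_congr_fun measurableSet_Ioc fun τ hτ => ?_
    have h1 : ∑ i, torusCoeff (fun x => weakGrad (u τ) x i) k
        * conj (torusCoeff (fun x => weakGrad (u τ) x i) k)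
        = eig k * (torusCoeff (u τ) k * conj (torusCoeff (u τ) k)) := by
      rw [← sum_grad_coeff_mul]
      refine Finset.sum_congr rfl fun i _ => ?_
      rw [(h.hasL2Grad τ ⟨hs.trans_lt hτ.1, hτ.2.trans ht⟩).torusCoeff_weakGrad]
    simp only
    rw [h1, map_add, map_mul, map_neg, Complex.conj_ofReal]; ring
  have key := h.integral_mul_sub hs hst ht hF hG (w := fun τ => u τ)
    (W := fun i τ x => weakGrad (u τ) x i) hu hG
    (fun τ hτ k i => (h.hasL2Grad τ ⟨hs.trans_lt hτ.1, hτ.2.trans ht⟩).torusCoeff_weakGrad k i)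
    (memLp_coe _) (memLp_coe _) (h.intervalIntegrable_rhs hs hst ht)
    (fun k τ hτ => h.ode_from hs hτ.1 (hτ.2.trans ht) k) hX
  have hsym : ∫ τ in s..t, ∫ x, u τ x * F τ x ∂torusMeasure N
      = ∫ τ in s..t, ∫ x, F τ x * u τ x ∂torusMeasure N := by simp only [mul_comm]
  have key' : ∫ x, u t x * u t x ∂torusMeasure N - ∫ x, u s x * u s x ∂torusMeasure N
      = -(∑ i, ∫ τ in s..t, ∫ x, weakGrad (u τ) x i * weakGrad (u τ) x i ∂torusMeasure N)
        + (∫ τ in s..t, ∫ x, F τ x * u τ x ∂torusMeasure N)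
        + (-(∑ i, ∫ τ in s..t, ∫ x, weakGrad (u τ) x i * weakGrad (u τ) x i ∂torusMeasure N)
        + ∫ τ in s..t, ∫ x, u τ x * F τ x ∂torusMeasure N) := by exact_mod_cast key
  rw [hsym, ← integral_sq_norm_grad hst hG] at key'
  simp only [← pow_two, integral_sq_eq_norm_sq] at key'
  linarith

/-- The dissipation of a heat flow is integrable up to the initial time. -/
theorem integrableOn_sq_norm_grad (h : IsHeatFlow T u F) (hT : 0 ≤ T) {M C : ℝ} (hC : 0 ≤ C)
    (hM : ∀ t ∈ Ioc 0 T, √t * ‖weakGrad (u t)‖ ≤ M)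
    (hF : ∀ᵐ τ ∂volume.restrict (Ioc 0 T), MemLp (F τ) 2 (torusMeasure N) ∧
      ∫ x, F τ x ^ 2 ∂torusMeasure N
        ≤ C * (1 + ∫ x, ‖weakGrad (u τ) x‖ ^ 2 ∂torusMeasure N)) :
    IntegrableOn (fun τ => ∫ x, ‖weakGrad (u τ) x‖ ^ 2 ∂torusMeasure N) (Ioc 0 T) := by
  obtain ⟨R, hR⟩ := isCompact_Icc.exists_bound_of_continuousOn h.cont
  have hR0 : 0 ≤ R := (norm_nonneg _).trans (hR 0 ⟨le_rfl, hT⟩)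
  set D : ℝ → ℝ := fun τ => ∫ x, ‖weakGrad (u τ) x‖ ^ 2 ∂torusMeasure N with hD
  have hD0 : ∀ τ, 0 ≤ D τ := fun τ => integral_nonneg fun x => by positivity
  have hG : ∀ s, 0 < s → ∀ i,
      SqIntegrable (volume.restrict (Ioc s T)) fun τ x => weakGrad (u τ) x i := fun s hs i => by
    -- Away from time zero, `√τ ‖∇u‖ ≤ M` gives `‖∇u‖² ≤ M²/τ ≤ M²/s`.
    refine h.sqIntegrable_grad hs.le le_rfl (D := fun _ => M ^ 2 / s) (integrableOn_const (by simp))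
      (fun τ hτ => ?_) i
    have hτ0 : 0 < τ := hs.trans hτ.1
    rw [integral_sq_norm_weakGrad_eq_norm_sq, le_div_iff₀ hs]
    have h1 := pow_le_pow_left₀ (by positivity) (hM τ ⟨hτ0, hτ.2⟩) 2
    rw [mul_pow, Real.sq_sqrt hτ0.le] at h1
    nlinarith [hτ.1, sq_nonneg ‖weakGrad (u τ)‖]
  have hDi : ∀ s, 0 < s → IntegrableOn D (Ioc s T) := fun s hs => integrable_sq_norm_grad (hG s hs)
  -- The bound must not depend on `s`: the energy identity on `[s,T]` is used in place of `M²/s`.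
  have hbound : ∀ s, 0 < s → s ≤ T → ∫ τ in Ioc s T, ‖D τ‖ ≤ R ^ 2 + (1 + (C + 1) * R ^ 2) * T := by
    intro s hs hsT
    have hle : volume.restrict (Ioc s T) ≤ volume.restrict (Ioc 0 T) :=
      Measure.restrict_mono (Ioc_subset_Ioc_left hs.le) le_rfl
    have hF' : ∀ᵐ τ ∂volume.restrict (Ioc s T), MemLp (F τ) 2 (torusMeasure N) ∧
      ∫ x, F τ x ^ 2 ∂torusMeasure N
        ≤ C * (1 + ∫ x, ‖weakGrad (u τ) x‖ ^ 2 ∂torusMeasure N) := ae_mono hle hF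
    have hFs : SqIntegrable (volume.restrict (Ioc s T)) F := by
      refine SqIntegrable.of_bound (hF'.mono fun τ hτ => hτ.1) (fun k => ?_)
        (h := fun τ => C * (1 + D τ)) ?_ (hF'.mono fun τ hτ => hτ.2)
      · exact ((intervalIntegrable_iff_integrableOn_Ioc_of_le hT).1
          (h.intervalIntegrable k)).1.mono_measure hle
      · exact (((integrable_const 1).add (hDi s hs)).const_mul C)
    have he := h.energy hs.le hsT le_rfl hFs (hG s hs)
    have hu := h.sqIntegrable (s := s) (t := T) hs.le le_rfl
    have hFu := hFs.integrable_integral_mul hu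
    have hpt : ∀ᵐ τ ∂volume.restrict (Ioc s T), 2 * ∫ x, F τ x * u τ x ∂torusMeasure N
        ≤ D τ + (1 + (C + 1) * R ^ 2) := by
      filter_upwards [hF', ae_restrict_mem measurableSet_Ioc] with τ hτ hτm
      -- The weight `(C+1)⁻¹` makes the forcing cost at most `1 + D τ`, one of the two copies of the
      -- dissipation in the energy identity. The `+1` keeps the weight finite when `C = 0`.
      have h1 := integral_mul_le_sq_add_sq hτ.1 (memLp_coe (u τ)) (c := (C + 1)⁻¹) (by positivity)
      rw [inv_inv, integral_sq_eq_norm_sq] at h1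
      have h2 : (C + 1)⁻¹ * ∫ x, F τ x ^ 2 ∂torusMeasure N ≤ 1 + D τ := by
        rw [inv_mul_le_iff₀ (by positivity)]
        refine hτ.2.trans ?_
        have := hD0 τ
        change C * (1 + D τ) ≤ (C + 1) * (1 + D τ)
        nlinarith
      have h3 : ‖u τ‖ ^ 2 ≤ R ^ 2 := pow_le_pow_left₀ (norm_nonneg _)
        (hR τ ⟨(hs.trans hτm.1).le, hτm.2⟩) 2
      have h4 : (C + 1) * ‖u τ‖ ^ 2 ≤ (C + 1) * R ^ 2 := by gcongr
      have h5 := le_abs_self (∫ x, F τ x * u τ x ∂torusMeasure N)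
      linarith
    have hmono := integral_mono_ae (hFu.const_mul 2) ((hDi s hs).add (integrable_const _)) hpt
    rw [integral_const_mul] at hmono
    have hsplit : ∫ τ in Ioc s T, (D τ + (1 + (C + 1) * R ^ 2))
        = (∫ τ in Ioc s T, D τ) + (1 + (C + 1) * R ^ 2) * (T - s) := by
      rw [integral_add (hDi s hs) (integrable_const _)]
      congr 1
      rw [integral_const]
      simp [hsT, mul_comm]
    have hmono' : 2 * ∫ τ in Ioc s T, ∫ x, F τ x * u τ x ∂torusMeasure N
        ≤ (∫ τ in Ioc s T, D τ) + (1 + (C + 1) * R ^ 2) * (T - s) := hsplit ▸ hmono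
    rw [intervalIntegral.integral_of_le hsT, intervalIntegral.integral_of_le hsT] at he
    change ‖u T‖ ^ 2 - ‖u s‖ ^ 2 = -2 * (∫ τ in Ioc s T, D τ) + _ at he
    have hn : ∫ τ in Ioc s T, ‖D τ‖ = ∫ τ in Ioc s T, D τ := by
      congr 1; funext τ; exact Real.norm_of_nonneg (hD0 τ)
    have h3 : ‖u s‖ ^ 2 ≤ R ^ 2 := pow_le_pow_left₀ (norm_nonneg _) (hR s ⟨hs.le, hsT⟩) 2
    have h6 : 0 ≤ (1 + (C + 1) * R ^ 2) * s := by positivity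
    rw [hn]
    nlinarith [sq_nonneg ‖u T‖]
  rcases hT.eq_or_lt with rfl | hT'
  · simp
  -- Uniformly bounded integrals of a nonnegative function over `(T/(n+1), T]` give integrability on
  -- `(0,T]`.
  refine integrableOn_Ioc_of_intervalIntegral_norm_bounded_left (a := fun n : ℕ => T / (n + 1))
    (l := atTop) (I := R ^ 2 + (1 + (C + 1) * R ^ 2) * T) (fun n => hDi _ (by positivity)) ?_
    (Eventually.of_forall fun n => hbound _ (by positivity) (div_le_self hT (by
      linarith [(n.cast_nonneg : (0 : ℝ) ≤ n)])))
  simpa [div_eq_mul_inv] using tendsto_one_div_add_atTop_nhds_zero_nat.const_mul T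

end IsHeatFlow

/-! ### Sobolev regularity and weak formulation of heat flows -/

theorem memLp_of_continuous {ψ : Torus N → ℝ} (h : Continuous ψ) (q : ℝ≥0∞) :
    MemLp ψ q (torusMeasure N) := by
  obtain ⟨C, hC⟩ := isCompact_univ.exists_bound_of_continuousOn h.continuousOn
  exact MemLp.of_bound h.aestronglyMeasurable C (Eventually.of_forall fun x => hC x (mem_univ _))

theorem sqIntegrable_of_continuous {ψ : ℝ → Torus N → ℝ} (h : Continuous (Function.uncurry ψ))
    (s t : ℝ) : SqIntegrable (volume.restrict (Ioc s t)) ψ := by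
  have hc : ∀ τ, Continuous (ψ τ) := fun τ => h.comp (by fun_prop : Continuous fun x => (τ, x))
  obtain ⟨C, hC⟩ := ((isCompact_Icc (a := s) (b := t)).prod
    (isCompact_univ (X := Torus N))).exists_bound_of_continuousOn h.continuousOn
  refine SqIntegrable.of_bound (h := fun _ => C ^ 2)
    (Eventually.of_forall fun τ => memLp_of_continuous (hc τ) 2)
    (fun k => (continuous_torusCoeff h k).aestronglyMeasurable) (integrable_const _) ?_
  filter_upwards [ae_restrict_mem measurableSet_Ioc] with τ hτ
  have h1 : ∫ x, ψ τ x ^ 2 ∂torusMeasure N ≤ ∫ _, C ^ 2 ∂torusMeasure N := by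
    refine integral_mono (memLp_of_continuous (hc τ) 2).integrable_sq (integrable_const _)
      fun x => ?_
    have h2 : ‖ψ τ x‖ ≤ C := hC (τ, x) ⟨Ioc_subset_Icc_self hτ, mem_univ _⟩
    simpa using pow_le_pow_left₀ (norm_nonneg _) h2 2
  simpa using h1

theorem sobolevNormSq_le {s B : ℝ} {c : (Fin N → ℤ) → ℂ} {b : (Fin N → ℤ) → ℝ} (hb : HasSum b B)
    (h : ∀ k, (1 + freqSq k) ^ s * ‖c k‖ ^ 2 ≤ b k) : sobolevNormSq s c ≤ ENNReal.ofReal B := by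
  have hf : ∀ k : Fin N → ℤ, 0 ≤ (1 + freqSq k) ^ s := fun k =>
    Real.rpow_nonneg (by linarith [freqSq_nonneg k]) s
  rw [← hb.tsum_eq, ENNReal.ofReal_tsum_of_nonneg
    (fun k => (mul_nonneg (hf k) (by positivity)).trans (h k)) hb.summable]
  refine ENNReal.tsum_le_tsum fun k => ?_
  rw [← ofReal_norm, ← ENNReal.ofReal_pow (norm_nonneg _), ← ENNReal.ofReal_mul (hf k)]
  exact ENNReal.ofReal_le_ofReal (h k)

theorem lintegral_lt_top_of_le_ofReal {T : ℝ} {f : ℝ → ℝ≥0∞} {h : ℝ → ℝ}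
    (hi : IntegrableOn h (Ioc 0 T)) (hle : ∀ᵐ t ∂volume.restrict (Ioc 0 T), f t ≤ ENNReal.ofReal (h t)) :
    ∫⁻ t in Icc 0 T, f t < ⊤ := by
  rw [setLIntegral_congr Ioc_ae_eq_Icc.symm]
  refine (lintegral_mono_ae hle).trans_lt (lt_of_le_of_lt ?_ hi.2)
  exact lintegral_mono fun t => Real.ofReal_le_enorm _

namespace IsHeatFlow

variable {T : ℝ} {u : ℝ → L2 N} {F : ℝ → Torus N → ℝ}

theorem lintegral_sobolevNormSq_one_lt_top (h : IsHeatFlow T u F)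
    (hG : ∀ i, SqIntegrable (volume.restrict (Ioc 0 T)) fun τ x => weakGrad (u τ) x i) :
    ∫⁻ t in Icc 0 T, sobolevNormSq 1 (torusCoeff (u t)) < ⊤ := by
  refine lintegral_lt_top_of_le_ofReal
    ((h.sqIntegrable le_rfl le_rfl).integrable_sq.add (integrable_sq_norm_grad hG)) ?_
  filter_upwards [ae_restrict_mem measurableSet_Ioc] with t ht
  refine sobolevNormSq_le
    ((hasSum_sq_norm_torusCoeff (memLp_coe (u t))).add (h.hasL2Grad t ht).hasSum_eig) fun k => ?_
  rw [Real.rpow_one, add_mul, one_mul]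
  have h5 : (1 : ℝ) ≤ 4 * Real.pi ^ 2 := by nlinarith [Real.pi_gt_three]
  have h6 : freqSq k ≤ eig k := le_mul_of_one_le_left (freqSq_nonneg k) h5
  gcongr

/-- The derivative is `Δu + F`, with coefficients `-λ û + F̂`. Since `λ ≤ 4π²(1+|k|²)`, the weight
of `H^{-1}` reduces `λ²|û|²` to a multiple of `λ|û|²`, the dissipation. -/
theorem hasTimeDerivL2HNegOne (h : IsHeatFlow T u F) (hT : 0 ≤ T)
    (hF : SqIntegrable (volume.restrict (Ioc 0 T)) F)
    (hG : ∀ i, SqIntegrable (volume.restrict (Ioc 0 T)) fun τ x => weakGrad (u τ) x i) :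
    HasTimeDerivL2HNegOne T u := by
  refine ⟨fun t k => -eig k * torusCoeff (u t) k + torusCoeff (F t) k, fun k => ?_, ?_, ?_⟩
  · rw [← restrict_Ioc_eq_restrict_Icc]
    exact ((intervalIntegrable_iff_integrableOn_Ioc_of_le hT).1
      (h.intervalIntegrable_rhs le_rfl hT le_rfl k)).1
  · refine lintegral_lt_top_of_le_ofReal (((integrable_sq_norm_grad hG).const_mul
      (8 * Real.pi ^ 2)).add (hF.integrable_sq.const_mul 2)) ?_
    filter_upwards [ae_restrict_mem measurableSet_Ioc, hF.memLp] with t ht hFt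
    refine sobolevNormSq_le (((h.hasL2Grad t ht).hasSum_eig.mul_left (8 * Real.pi ^ 2)).add
      ((hasSum_sq_norm_torusCoeff hFt).mul_left 2)) fun k => ?_
    have hk := freqSq_nonneg k
    have hk1 : 0 < 1 + freqSq k := by linarith
    rw [Real.rpow_neg_one, inv_mul_le_iff₀ hk1]
    have h1 : ‖-eig k * torusCoeff (u t) k + torusCoeff (F t) k‖
        ≤ eig k * ‖torusCoeff (u t) k‖ + ‖torusCoeff (F t) k‖ := by
      refine (norm_add_le _ _).trans (le_of_eq ?_)
      rw [norm_mul, norm_neg, Complex.norm_real, Real.norm_of_nonneg (eig_nonneg k)]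
    have h2 := pow_le_pow_left₀ (norm_nonneg _) h1 2
    have h3 : (eig k * ‖torusCoeff (u t) k‖ + ‖torusCoeff (F t) k‖) ^ 2
        ≤ 2 * (eig k * (eig k * ‖torusCoeff (u t) k‖ ^ 2)) + 2 * ‖torusCoeff (F t) k‖ ^ 2 := by
      nlinarith [sq_nonneg (eig k * ‖torusCoeff (u t) k‖ - ‖torusCoeff (F t) k‖)]
    have h4 : 0 ≤ eig k * ‖torusCoeff (u t) k‖ ^ 2 := mul_nonneg (eig_nonneg k) (by positivity)
    have h5 : eig k ≤ (1 + freqSq k) * (4 * Real.pi ^ 2) := by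
      unfold eig; nlinarith [sq_nonneg Real.pi]
    have h6 := mul_le_mul_of_nonneg_right h5 h4
    have h7 : 0 ≤ freqSq k * ‖torusCoeff (F t) k‖ ^ 2 := by positivity
    refine (h2.trans h3).trans ?_
    nlinarith
  · intro ψ hψ hsupp k
    -- Support in the open interval makes both boundary terms of the product rule vanish.
    have h0 : ∀ t, t ∉ Ioo 0 T → ψ t = 0 := fun t ht => by
      by_contra hne
      exact ht (hsupp (subset_tsupport ψ hne))
    have hd : Continuous (deriv ψ) := hψ.continuous_deriv (by simp)
    have hdc : Continuous fun τ => ((deriv ψ τ : ℝ) : ℂ) := Complex.continuous_ofReal.comp hd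
    have hψc : Continuous fun τ => (ψ τ : ℂ) := Complex.continuous_ofReal.comp hψ.continuous
    have hα := h.intervalIntegrable_rhs le_rfl hT le_rfl k
    have hp := mul_sub_mul_eq_integral (a := fun τ => torusCoeff (u τ) k)
      (b := fun τ => (ψ τ : ℂ)) hT hα (hdc.intervalIntegrable _ _)
      (fun τ hτ => h.ode k τ hτ) (fun τ _ => by
        rw [intervalIntegral.integral_ofReal, intervalIntegral.integral_deriv_eq_sub
          (fun x _ => (hψ.differentiable (by simp)).differentiableAt)
          (hd.intervalIntegrable _ _)]
        push_cast; ring)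
    rw [h0 T (by simp), h0 0 (by simp), intervalIntegral.integral_add
      (hα.mul_continuousOn hψc.continuousOn)
      ((hdc.intervalIntegrable _ _).continuousOn_mul
        (by rw [uIcc_of_le hT]; exact h.continuousOn_coeff k))] at hp
    simp only [Complex.ofReal_zero, mul_zero, sub_zero] at hp
    rw [eq_neg_iff_add_eq_zero, add_comm]
    simpa only [mul_comm] using hp.symm

/-- The weak formulation for a heat flow. -/
theorem weak (h : IsHeatFlow T u F) (hT : 0 ≤ T)
    (hF : SqIntegrable (volume.restrict (Ioc 0 T)) F)
    (hG : ∀ i, SqIntegrable (volume.restrict (Ioc 0 T)) fun τ x => weakGrad (u τ) x i)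
    {φ : ℝ → Torus N → ℝ} (hφ : IsTestFunction T φ) :
    (∫ x, u 0 x * φ 0 x ∂torusMeasure N)
      + (∫ t in 0..T, ∫ x, u t x * deriv (fun s => φ s x) t ∂torusMeasure N) =
    (∫ t in 0..T, ∫ x, inner ℝ (weakGrad (u t) x) (grad (φ t) x) ∂torusMeasure N)
      - ∫ t in 0..T, ∫ x, F t x * φ t x ∂torusMeasure N := by
  -- Test functions vanish from some `T' < T` on, so only the boundary term at time zero survives.
  have hφT : φ T = 0 := by
    obtain ⟨T', hT', hz⟩ := hφ.2
    funext x; exact hz T hT'.le x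
  have hW := fun i => sqIntegrable_of_continuous (hφ.continuous_grad i) 0 T
  have hX := (h.sqIntegrable le_rfl le_rfl).hasSum_integral_coeff_mul
    (sqIntegrable_of_continuous hφ.continuous_deriv 0 T)
  simp only [← intervalIntegral.integral_of_le hT] at hX
  have hc : ∀ k, Continuous fun t => torusCoeff (fun x => deriv (fun s => φ s x) t) k :=
    continuous_torusCoeff hφ.continuous_deriv
  have key := h.integral_mul_sub le_rfl hT le_rfl hF hG
    (sqIntegrable_of_continuous hφ.continuous_uncurry 0 T) hW
    (fun τ _ k i => hφ.torusCoeff_grad τ k i) (memLp_of_continuous (hφ.continuous_apply 0) 2)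
    (memLp_of_continuous (hφ.continuous_apply T) 2)
    (fun k => (hc k).intervalIntegrable _ _) (fun k τ _ => by
      rw [intervalIntegral.integral_eq_sub_of_hasDerivAt
        (fun x _ => hφ.hasDerivAt_torusCoeff k x) ((hc k).intervalIntegrable _ _)]
      ring) hX
  have key' : ∫ x, u T x * φ T x ∂torusMeasure N - ∫ x, u 0 x * φ 0 x ∂torusMeasure N
      = -(∑ i, ∫ τ in (0 : ℝ)..T, ∫ x, weakGrad (u τ) x i * grad (φ τ) x i ∂torusMeasure N)
        + (∫ τ in (0 : ℝ)..T, ∫ x, F τ x * φ τ x ∂torusMeasure N)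
        + ∫ τ in (0 : ℝ)..T, ∫ x, u τ x * deriv (fun s => φ s x) τ ∂torusMeasure N := by
    exact_mod_cast key
  have hin : ∫ t in 0..T, ∫ x, inner ℝ (weakGrad (u t) x) (grad (φ t) x) ∂torusMeasure N
      = ∑ i, ∫ τ in (0 : ℝ)..T, ∫ x, weakGrad (u τ) x i * grad (φ τ) x i ∂torusMeasure N := by
    simp only [intervalIntegral.integral_of_le hT]
    rw [← integral_finsetSum _ fun i _ => (hG i).integrable_integral_mul (hW i)]
    refine integral_congr_ae ?_
    have hWm : ∀ᵐ τ ∂volume.restrict (Ioc 0 T), ∀ i,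
        MemLp (fun x => grad (φ τ) x i) 2 (torusMeasure N) := ae_all_iff.2 fun i => (hW i).memLp
    filter_upwards [hWm] with τ hτ
    have hi : ∀ i, Integrable (fun x => weakGrad (u τ) x i * grad (φ τ) x i) (torusMeasure N) :=
      fun i => (memLp_weakGrad_apply (u τ) i).integrable_mul (hτ i)
    rw [← integral_finsetSum _ fun i _ => hi i]
    simp [PiLp.inner_apply, mul_comm]
  rw [hφT] at key'
  simp only [Pi.zero_apply, mul_zero, integral_zero] at key'
  rw [hin]
  linarith

end IsHeatFlow

/-! ### From Duhamel's formula to the heat equation -/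

section Heat

variable {w : ℝ → Torus N → ℝ} {t : ℝ}

/-- In a fixed mode the heat factor is a scalar whose inverse `e^{λ(t-τ)}` is continuous on `[0,t]`,
so integrability of the Duhamel integrand passes to the coefficient of `w` itself. -/
theorem intervalIntegrable_torusCoeff_of_heat (ht : 0 ≤ t)
    (hw : ∀ᵐ τ ∂volume.restrict (Ioc 0 t), MemLp (w τ) 2 (torusMeasure N))
    (hi : IntervalIntegrable (fun τ => heat (t - τ) (w τ)) volume 0 t) (k : Fin N → ℤ) :
    IntervalIntegrable (fun τ => torusCoeff (w τ) k) volume 0 t := by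
  have h1 : IntervalIntegrable (fun τ => torusCoeff (heat (t - τ) (w τ)) k) volume 0 t := by
    rw [intervalIntegrable_iff_integrableOn_Ioc_of_le ht] at hi ⊢
    exact (coeffCLM k).integrable_comp hi
  have he : ContinuousOn (fun τ : ℝ => (Real.exp (eig k * (t - τ)) : ℂ)) (uIcc 0 t) := by
    fun_prop
  have h2 := h1.continuousOn_mul he
  rw [intervalIntegrable_iff_integrableOn_Ioc_of_le ht] at h2 ⊢
  refine h2.congr ?_
  filter_upwards [hw, ae_restrict_mem measurableSet_Ioc] with τ hτ hτm
  rw [torusCoeff_heat hτ (sub_nonneg.2 hτm.2), ← mul_assoc, ← Complex.ofReal_mul, ← Real.exp_add]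
  simp

theorem torusCoeff_integral_heat (ht : 0 ≤ t)
    (hw : ∀ᵐ τ ∂volume.restrict (Ioc 0 t), MemLp (w τ) 2 (torusMeasure N))
    (hi : IntervalIntegrable (fun τ => heat (t - τ) (w τ)) volume 0 t) (k : Fin N → ℤ) :
    coeffCLM k (∫ τ in 0..t, heat (t - τ) (w τ))
      = ∫ τ in 0..t, (Real.exp (-eig k * (t - τ)) : ℂ) * torusCoeff (w τ) k := by
  rw [← (coeffCLM k).intervalIntegral_comp_comm hi, intervalIntegral.integral_of_le ht,
    intervalIntegral.integral_of_le ht]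
  refine integral_congr_ae ?_
  filter_upwards [hw, ae_restrict_mem measurableSet_Ioc] with τ hτ hτm
  exact torusCoeff_heat hτ (sub_nonneg.2 hτm.2) k

end Heat

/-- The forcing `|u|^p - w·∇u - ∫ |u|^p` of the heat equation. -/
def forcing (p : ℝ) (v : ℝ → Torus N → EuclideanSpace ℝ (Fin N)) (u : ℝ → L2 N)
    (τ : ℝ) (x : Torus N) : ℝ :=
  absPow p (u τ) x - advect (v τ) (u τ) x - ∫ y, absPow p (u τ) y ∂torusMeasure N

section Mild

variable {p T : ℝ} {v : ℝ → Torus N → EuclideanSpace ℝ (Fin N)} {u₀ : L2 N} {u : ℝ → L2 N}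

theorem torusCoeff_forcing {τ : ℝ} (hB : MemLp (absPow p (u τ)) 2 (torusMeasure N))
    (hA : MemLp (advect (v τ) (u τ)) 2 (torusMeasure N)) (k : Fin N → ℤ) :
    torusCoeff (forcing p v u τ) k = torusCoeff (absPow p (u τ)) k
      - torusCoeff (advect (v τ) (u τ)) k
      - if k = 0 then ((∫ y, absPow p (u τ) y ∂torusMeasure N : ℝ) : ℂ) else 0 := by
  have hB1 := hB.integrable (by norm_num)
  have hA1 := hA.integrable (by norm_num)
  rw [← torusCoeff_const, ← torusCoeff_sub hB1 hA1]
  exact torusCoeff_sub (hB1.sub hA1) (integrable_const _) k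

theorem IsMildSolution.torusCoeff_zero_time (hu : IsMildSolution p v u₀ T u) (hT : 0 ≤ T)
    (k : Fin N → ℤ) : torusCoeff (u 0) k = torusCoeff u₀ k := by
  obtain ⟨-, -, -, h⟩ := hu.2.2 0 ⟨le_rfl, hT⟩
  simp only [intervalIntegral.integral_same, add_zero, sub_zero, map_zero] at h
  rw [h, torusCoeff_heat (memLp_coe u₀) le_rfl]
  simp

theorem IsMildSolution.eq_zero_time (hu : IsMildSolution p v u₀ T u) (hT : 0 ≤ T) :
    u 0 = u₀ := by
  have h : ∀ k, torusCoeff (u 0 - u₀ : L2 N) k = 0 := fun k => by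
    rw [← coeffCLM_apply, map_sub, coeffCLM_apply, coeffCLM_apply, hu.torusCoeff_zero_time hT,
      sub_self]
  have h2 := hasSum_sq_norm_torusCoeff (memLp_coe (u 0 - u₀))
  simp only [h, norm_zero, ne_eq, OfNat.ofNat_ne_zero, not_false_eq_true, zero_pow,
    integral_sq_eq_norm_sq] at h2
  have h3 := h2.unique hasSum_zero
  exact sub_eq_zero.1 (norm_eq_zero.1 (pow_eq_zero_iff (by norm_num) |>.1 h3))

theorem coeffCLM_const (c : ℝ) (k : Fin N → ℤ) :
    coeffCLM k (Lp.const 2 (torusMeasure N) c) = if k = 0 then (c : ℂ) else 0 := by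
  rw [coeffCLM_apply, ← torusCoeff_const]
  exact torusCoeff_congr_ae (Lp.coeFn_const 2 (torusMeasure N) c) k

theorem eig_zero : eig (0 : Fin N → ℤ) = 0 := by simp [eig, freqSq]

/-- A mild solution solves the heat equation with forcing, mode by mode. -/
theorem IsMildSolution.isHeatFlow (hu : IsMildSolution p v u₀ T u) (hT : 0 ≤ T)
    (hB : ∀ᵐ τ ∂volume.restrict (Ioc 0 T), MemLp (absPow p (u τ)) 2 (torusMeasure N))
    (hA : ∀ᵐ τ ∂volume.restrict (Ioc 0 T), MemLp (advect (v τ) (u τ)) 2 (torusMeasure N)) :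
    IsHeatFlow T u (forcing p v u) := by
  obtain ⟨hB1, hA1, hm1, -⟩ := hu.2.2 T ⟨hT, le_rfl⟩
  have hBk := intervalIntegrable_torusCoeff_of_heat hT hB hB1
  have hAk := intervalIntegrable_torusCoeff_of_heat hT hA hA1
  have hmk : ∀ k : Fin N → ℤ, IntervalIntegrable (fun τ => if k = 0 then
      ((∫ y, absPow p (u τ) y ∂torusMeasure N : ℝ) : ℂ) else 0) volume 0 T := fun k => by
    split_ifs
    · rw [intervalIntegrable_iff_integrableOn_Ioc_of_le hT] at hm1 ⊢
      exact hm1.ofReal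
    · exact intervalIntegrable_const
  have hFk : ∀ k, IntervalIntegrable (fun τ => torusCoeff (forcing p v u τ) k) volume 0 T :=
    fun k => by
      have h := ((hBk k).sub (hAk k)).sub (hmk k)
      rw [intervalIntegrable_iff_integrableOn_Ioc_of_le hT] at h ⊢
      refine h.congr ?_
      filter_upwards [hB, hA] with τ h1 h2
      exact (torusCoeff_forcing h1 h2 k).symm
  refine ⟨hu.1, hu.2.1, hFk, fun k t ht => ?_⟩
  refine eq_add_integral_of_duhamel (a := fun t => torusCoeff (u t) k) (hFk k)
    (fun t ht => ?_) ht
  obtain ⟨hBt, hAt, hmt, h⟩ := hu.2.2 t ht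
  have hle : volume.restrict (Ioc 0 t) ≤ volume.restrict (Ioc 0 T) :=
    Measure.restrict_mono (Ioc_subset_Ioc_right ht.2) le_rfl
  have hsub : uIcc 0 t ⊆ uIcc 0 T := by
    rw [uIcc_of_le ht.1, uIcc_of_le hT]; exact Icc_subset_Icc_right ht.2
  have h0 := congrArg (coeffCLM k) h
  rw [map_sub, map_sub, map_add, torusCoeff_integral_heat ht.1 (ae_mono hle hB) hBt,
    torusCoeff_integral_heat ht.1 (ae_mono hle hA) hAt, coeffCLM_const, coeffCLM_apply,
    coeffCLM_apply, torusCoeff_heat (memLp_coe u₀) ht.1] at h0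
  rw [h0, hu.torusCoeff_zero_time hT, add_sub_assoc, add_sub_assoc]
  congr 1
  have he : ContinuousOn (fun τ : ℝ => (Real.exp (-eig k * (t - τ)) : ℂ)) (uIcc 0 t) := by
    fun_prop
  -- The mean term carries no heat factor in the mild formulation; one can be inserted because the
  -- mean lives in the mode `k = 0`, where the eigenvalue is zero.
  have hmm : (if k = 0 then ((∫ τ in 0..t, ∫ y, absPow p (u τ) y ∂torusMeasure N : ℝ) : ℂ) else 0)
      = ∫ τ in 0..t, (Real.exp (-eig k * (t - τ)) : ℂ) *
        (if k = 0 then ((∫ y, absPow p (u τ) y ∂torusMeasure N : ℝ) : ℂ) else 0) := by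
    split_ifs with hk
    · subst hk
      simp [eig_zero, intervalIntegral.integral_ofReal]
    · simp
  rw [hmm, ← intervalIntegral.integral_sub, ← intervalIntegral.integral_sub]
  · rw [intervalIntegral.integral_of_le ht.1, intervalIntegral.integral_of_le ht.1]
    refine integral_congr_ae ?_
    filter_upwards [ae_mono hle hB, ae_mono hle hA] with τ h1 h2
    rw [torusCoeff_forcing h1 h2 k]; ring
  · exact (((hBk k).mono_set hsub).continuousOn_mul he).sub
      (((hAk k).mono_set hsub).continuousOn_mul he)
  · exact ((hmk k).mono_set hsub).continuousOn_mul he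
  · exact ((hBk k).mono_set hsub).continuousOn_mul he
  · exact ((hAk k).mono_set hsub).continuousOn_mul he

end Mild

/-! ### Square-integral bounds for the forcing -/

theorem IsBoundedFlow.exists_bound {v : ℝ → Torus N → EuclideanSpace ℝ (Fin N)}
    (hv : IsBoundedFlow v) :
    ∃ V : ℝ, ∀ᵐ t ∂volume.restrict (Ioi (0 : ℝ)), AEStronglyMeasurable (v t) (torusMeasure N) ∧
      ∀ᵐ x ∂torusMeasure N, ‖v t x‖ ≤ V := by
  have hne : eLpNormEssSup (Function.uncurry v)
      ((volume.restrict (Ioi (0 : ℝ))).prod (torusMeasure N)) ≠ ⊤ := by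
    rw [← eLpNorm_exponent_top]; exact hv.2.ne
  refine ⟨(eLpNormEssSup (Function.uncurry v)
    ((volume.restrict (Ioi (0 : ℝ))).prod (torusMeasure N))).toReal, ?_⟩
  have h1 := Measure.ae_ae_of_ae_prod (ae_le_eLpNormEssSup (f := Function.uncurry v)
    (μ := (volume.restrict (Ioi (0 : ℝ))).prod (torusMeasure N)))
  filter_upwards [hv.1.prodMk_left, h1] with t ht1 ht2
  refine ⟨ht1, ht2.mono fun x hx => ?_⟩
  rw [← toReal_enorm]
  exact ENNReal.toReal_mono hne hx

section Nonlinearities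

variable {w : Torus N → EuclideanSpace ℝ (Fin N)} {V : ℝ} {f : L2 N}

theorem memLp_advect (hwm : AEStronglyMeasurable w (torusMeasure N))
    (hV : ∀ᵐ x ∂torusMeasure N, ‖w x‖ ≤ V) :
    MemLp (advect w f) 2 (torusMeasure N) ∧
      ∫ x, advect w f x ^ 2 ∂torusMeasure N
        ≤ V ^ 2 * ∫ x, ‖weakGrad f x‖ ^ 2 ∂torusMeasure N := by
  have hG := Lp.memLp (weakGrad f)
  have hle : ∀ᵐ x ∂torusMeasure N, ‖advect w f x‖ ≤ V * ‖weakGrad f x‖ :=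
    hV.mono fun x hx => (norm_inner_le_norm _ _).trans
      (mul_le_mul_of_nonneg_right hx (norm_nonneg _))
  have hA : MemLp (advect w f) 2 (torusMeasure N) := hG.of_le_mul (hwm.inner hG.1) hle
  refine ⟨hA, ?_⟩
  rw [← integral_const_mul]
  refine integral_mono_ae hA.integrable_sq
    (((memLp_two_iff_integrable_sq_norm hG.1).1 hG).const_mul _) ?_
  filter_upwards [hle] with x hx
  rw [← mul_pow, ← sq_abs (advect w f x), ← Real.norm_eq_abs]
  exact pow_le_pow_left₀ (norm_nonneg _) hx 2

/-- Bessel's inequality for the zero mode. -/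
theorem sq_integral_le {h : Torus N → ℝ} (hh : MemLp h 2 (torusMeasure N)) :
    (∫ x, h x ∂torusMeasure N) ^ 2 ≤ ∫ x, h x ^ 2 ∂torusMeasure N := by
  have h1 := sq_norm_torusCoeff_le hh 0
  rwa [torusCoeff_zero, Complex.norm_real, Real.norm_eq_abs, sq_abs] at h1

/-- The three terms of the forcing cost a factor 3 each; the squared mean is at most the integral of
`(|u|^p)²`, which raises that coefficient to 6. -/
theorem memLp_forcing {p : ℝ} {v : ℝ → Torus N → EuclideanSpace ℝ (Fin N)} {u : ℝ → L2 N} {τ : ℝ}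
    (hB : MemLp (absPow p (u τ)) 2 (torusMeasure N))
    (hA : MemLp (advect (v τ) (u τ)) 2 (torusMeasure N)) :
    MemLp (forcing p v u τ) 2 (torusMeasure N) ∧
      ∫ x, forcing p v u τ x ^ 2 ∂torusMeasure N
        ≤ 6 * (∫ x, absPow p (u τ) x ^ 2 ∂torusMeasure N)
          + 3 * ∫ x, advect (v τ) (u τ) x ^ 2 ∂torusMeasure N := by
  have hF : MemLp (forcing p v u τ) 2 (torusMeasure N) := (hB.sub hA).sub (memLp_const _)
  refine ⟨hF, ?_⟩
  set m := ∫ y, absPow p (u τ) y ∂torusMeasure N with hm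
  have hm2 := sq_integral_le hB
  have h1 : ∫ x, forcing p v u τ x ^ 2 ∂torusMeasure N
      ≤ ∫ x, (3 * absPow p (u τ) x ^ 2 + 3 * advect (v τ) (u τ) x ^ 2 + 3 * m ^ 2)
        ∂torusMeasure N := by
    refine integral_mono hF.integrable_sq (((hB.integrable_sq.const_mul 3).add
      (hA.integrable_sq.const_mul 3)).add (integrable_const _)) fun x => ?_
    simp only [forcing, ← hm]
    nlinarith [sq_nonneg (absPow p (u τ) x + advect (v τ) (u τ) x),
      sq_nonneg (absPow p (u τ) x + m), sq_nonneg (advect (v τ) (u τ) x - m)]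
  have h2 : Integrable (fun x => 3 * absPow p (u τ) x ^ 2 + 3 * advect (v τ) (u τ) x ^ 2)
      (torusMeasure N) := (hB.integrable_sq.const_mul 3).add (hA.integrable_sq.const_mul 3)
  rw [integral_add h2 (integrable_const _), integral_add (hB.integrable_sq.const_mul 3)
    (hA.integrable_sq.const_mul 3), integral_const_mul, integral_const_mul] at h1
  simp only [integral_const, probReal_univ, one_smul] at h1
  linarith

theorem integral_forcing_mul {p : ℝ} {v : ℝ → Torus N → EuclideanSpace ℝ (Fin N)}
    {u : ℝ → L2 N} {τ : ℝ} (hB : MemLp (absPow p (u τ)) 2 (torusMeasure N))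
    (hA : MemLp (advect (v τ) (u τ)) 2 (torusMeasure N)) {ψ : Torus N → ℝ}
    (hψ : MemLp ψ 2 (torusMeasure N)) :
    ∫ x, forcing p v u τ x * ψ x ∂torusMeasure N
      = ∫ x, absPow p (u τ) x * ψ x ∂torusMeasure N
        - ∫ x, ψ x * advect (v τ) (u τ) x ∂torusMeasure N
        - (∫ x, absPow p (u τ) x ∂torusMeasure N) * ∫ x, ψ x ∂torusMeasure N := by
  have h1 : Integrable (fun x => absPow p (u τ) x * ψ x) (torusMeasure N) := hB.integrable_mul hψ
  have h2 : Integrable (fun x => ψ x * advect (v τ) (u τ) x) (torusMeasure N) :=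
    hψ.integrable_mul hA
  have h3 : Integrable (fun x => (∫ x, absPow p (u τ) x ∂torusMeasure N) * ψ x)
    (torusMeasure N) := (hψ.integrable (by norm_num)).const_mul _
  rw [← integral_const_mul, ← integral_sub h1 h2, ← integral_sub _ h3]
  · congr 1; funext x; simp only [forcing]; ring
  · exact h1.sub h2

end Nonlinearities

/-! ### Regularity of mild solutions and the energy identity -/

theorem continuousOn_abs {u : ℝ → L2 N} {s : Set ℝ} (hu : ContinuousOn u s) :
    ContinuousOn (fun τ => |u τ|) s := by
  have h : Continuous fun f : L2 N => |f| := continuous_id.sup continuous_neg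
  exact h.comp_continuousOn hu

/-- Taking absolute values is continuous on the lattice `L²`. This makes `∫ |u|^p |u|` a pairing of
two square integrable curves. -/
theorem sqIntegrable_abs {u : ℝ → L2 N} {s t : ℝ} (hu : ContinuousOn u (Icc s t)) :
    SqIntegrable (volume.restrict (Ioc s t)) fun τ x => |u τ x| := by
  refine ⟨Eventually.of_forall fun τ => (memLp_coe (u τ)).abs, fun k => ?_, ?_⟩
  · have h1 : (fun τ => torusCoeff (fun x => |u τ x|) k) = fun τ => coeffCLM k |u τ| := by
      funext τ
      exact (torusCoeff_congr_ae (Lp.coeFn_abs (u τ)) k).symm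
    rw [h1]
    exact (((coeffCLM k).continuous.comp_continuousOn (continuousOn_abs hu)).aestronglyMeasurable
      measurableSet_Icc).mono_measure (Measure.restrict_mono Ioc_subset_Icc_self le_rfl)
  · simp only [sq_abs, integral_sq_eq_norm_sq]
    exact ((hu.norm.pow 2).integrableOn_compact isCompact_Icc).mono_set Ioc_subset_Icc_self

/-- The nonlinear terms along a mild solution of class `X_T`, and the regularity that they
provide. -/
structure IsRegularSolution (p T : ℝ) (v : ℝ → Torus N → EuclideanSpace ℝ (Fin N))
    (u : ℝ → L2 N) : Prop where
  flow : IsHeatFlow T u (forcing p v u)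
  absPow : SqIntegrable (volume.restrict (Ioc 0 T)) fun τ => absPow p (u τ)
  advect : SqIntegrable (volume.restrict (Ioc 0 T)) fun τ => advect (v τ) (u τ)
  forcing : SqIntegrable (volume.restrict (Ioc 0 T)) (forcing p v u)
  grad : ∀ i, SqIntegrable (volume.restrict (Ioc 0 T)) fun τ x => weakGrad (u τ) x i

variable {p T : ℝ} {v : ℝ → Torus N → EuclideanSpace ℝ (Fin N)} {u₀ : L2 N} {u : ℝ → L2 N}

theorem IsMildSolution.isRegularSolution (hN : 1 ≤ N) (hp1 : 1 ≤ p) (hp2 : p < 1 + 2 / (N : ℝ))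
    (hv : IsBoundedFlow v) (hT : 0 < T) (huX : MemX T u) (hu : IsMildSolution p v u₀ T u) :
    IsRegularSolution p T v u := by
  obtain ⟨V, hV⟩ := hv.exists_bound
  obtain ⟨M, hM⟩ := huX.2
  obtain ⟨R, hR⟩ := isCompact_Icc.exists_bound_of_continuousOn huX.1
  have hR0 : 0 ≤ R := (norm_nonneg _).trans (hR 0 ⟨le_rfl, hT.le⟩)
  -- The radius must be positive, hence `R + 1`.
  obtain ⟨C, hC0, hC⟩ := exists_memLp_absRpow hN hp1 hp2 (R := R + 1) (by linarith)
  set D : ℝ → ℝ := fun τ => ∫ x, ‖weakGrad (u τ) x‖ ^ 2 ∂torusMeasure N with hD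
  have hD0 : ∀ τ, 0 ≤ D τ := fun τ => integral_nonneg fun x => by positivity
  have hB : ∀ᵐ τ ∂volume.restrict (Ioc 0 T), MemLp (TorusPDE.absPow p (u τ)) 2 (torusMeasure N) ∧
      ∫ x, TorusPDE.absPow p (u τ) x ^ 2 ∂torusMeasure N ≤ C * (1 + D τ) := by
    filter_upwards [ae_restrict_mem measurableSet_Ioc] with τ hτ
    refine hC (u τ) (memLp_coe _) ?_ (D τ) (hD0 τ) fun s => ?_
    · rw [integral_sq_eq_norm_sq]
      refine pow_le_pow_left₀ (norm_nonneg _) ((hR τ ⟨hτ.1.le, hτ.2⟩).trans (by linarith)) 2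
    · exact sum_le_hasSum s (fun k _ => mul_nonneg (eig_nonneg k) (by positivity))
        (hM τ hτ).1.hasSum_eig
  have hA : ∀ᵐ τ ∂volume.restrict (Ioc 0 T),
      MemLp (TorusPDE.advect (v τ) (u τ)) 2 (torusMeasure N) ∧
      ∫ x, TorusPDE.advect (v τ) (u τ) x ^ 2 ∂torusMeasure N ≤ V ^ 2 * D τ := by
    have hV' := ae_mono (Measure.restrict_mono Ioc_subset_Ioi_self le_rfl :
      volume.restrict (Ioc 0 T) ≤ volume.restrict (Ioi 0)) hV
    filter_upwards [hV'] with τ hτ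
    exact memLp_advect hτ.1 hτ.2
  have hF : ∀ᵐ τ ∂volume.restrict (Ioc 0 T),
      MemLp (TorusPDE.forcing p v u τ) 2 (torusMeasure N) ∧
      ∫ x, TorusPDE.forcing p v u τ x ^ 2 ∂torusMeasure N
        ≤ (6 * C + 3 * V ^ 2) * (1 + D τ) := by
    filter_upwards [hB, hA] with τ h1 h2
    have h3 := memLp_forcing h1.1 h2.1
    refine ⟨h3.1, h3.2.trans ?_⟩
    nlinarith [h1.2, h2.2, sq_nonneg V, hD0 τ]
  -- The heat equation needs only that the terms are in `L²` at almost every time. It gives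
  -- integrability of the dissipation, which turns the pointwise bounds in `D τ` into square
  -- integrability in time.
  have flow := hu.isHeatFlow hT.le (hB.mono fun τ h => h.1) (hA.mono fun τ h => h.1)
  have hDi : IntegrableOn D (Ioc 0 T) := flow.integrableOn_sq_norm_grad hT.le
    (by positivity) (fun t ht => (hM t ht).2) hF
  have hDC : ∀ c : ℝ, Integrable (fun τ => c * (1 + D τ)) (volume.restrict (Ioc 0 T)) :=
    fun c => ((integrable_const 1).add hDi).const_mul c
  obtain ⟨hB1, hA1, -, -⟩ := hu.2.2 T ⟨hT.le, le_rfl⟩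
  have hmeas : ∀ {c : ℝ → ℂ}, IntervalIntegrable c volume 0 T →
      AEStronglyMeasurable c (volume.restrict (Ioc 0 T)) := fun h =>
    ((intervalIntegrable_iff_integrableOn_Ioc_of_le hT.le).1 h).1
  have hB' := hB.mono fun τ h => h.1
  have hA' := hA.mono fun τ h => h.1
  exact ⟨flow,
    .of_bound hB' (fun k => hmeas (intervalIntegrable_torusCoeff_of_heat hT.le hB' hB1 k))
      (hDC C) (hB.mono fun τ h => h.2),
    .of_bound hA' (fun k => hmeas (intervalIntegrable_torusCoeff_of_heat hT.le hA' hA1 k))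
      (hDi.const_mul (V ^ 2)) (hA.mono fun τ h => h.2),
    .of_bound (hF.mono fun τ h => h.1) (fun k => hmeas (flow.intervalIntegrable k))
      (hDC _) (hF.mono fun τ h => h.2),
    fun i => flow.sqIntegrable_grad le_rfl le_rfl hDi (fun τ _ => le_rfl) i⟩

theorem IsRegularSolution.isWeakSolution (h : IsRegularSolution p T v u) (hT : 0 < T)
    (hu : IsMildSolution p v u₀ T u) : IsWeakSolution p v u₀ T u := by
  refine ⟨?_, h.flow.lintegral_sobolevNormSq_one_lt_top h.grad,
    h.flow.hasTimeDerivL2HNegOne hT.le h.forcing h.grad, ?_,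
    (hu.2.2 T ⟨hT.le, le_rfl⟩).2.2.1, ?_, fun φ hφ => ?_⟩
  · obtain ⟨R, hR⟩ := isCompact_Icc.exists_bound_of_continuousOn hu.1
    exact memLp_top_of_bound (hu.1.aestronglyMeasurable measurableSet_Icc) R
      ((ae_restrict_mem measurableSet_Icc).mono hR)
  · rw [← restrict_Ioc_eq_restrict_Icc]
    filter_upwards [h.absPow.memLp, h.advect.memLp] with t h1 h2
    exact ⟨h1.integrable (by norm_num), h2.integrable (by norm_num)⟩
  · rw [intervalIntegrable_iff_integrableOn_Ioc_of_le hT.le]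
    exact h.advect.integrable_integral_abs
  · have hw := h.flow.weak hT.le h.forcing h.grad hφ
    rw [hu.eq_zero_time hT.le] at hw
    rw [hw]
    have hφS := sqIntegrable_of_continuous hφ.continuous_uncurry 0 T
    have h1 := h.absPow.integrable_integral_mul hφS
    have h2 := hφS.integrable_integral_mul h.advect
    have h3 := h.forcing.integrable_integral_mul hφS
    have hae : ∀ᵐ τ ∂volume.restrict (Ioc 0 T), ∫ x, TorusPDE.forcing p v u τ x * φ τ x ∂torusMeasure N
        = ∫ x, TorusPDE.absPow p (u τ) x * φ τ x ∂torusMeasure N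
        - ∫ x, φ τ x * TorusPDE.advect (v τ) (u τ) x ∂torusMeasure N
        - (∫ x, TorusPDE.absPow p (u τ) x ∂torusMeasure N) * ∫ x, φ τ x ∂torusMeasure N := by
      filter_upwards [h.absPow.memLp, h.advect.memLp, hφS.memLp] with τ h1 h2 h3
      exact integral_forcing_mul h1 h2 h3
    -- The product of means needs no estimate of its own: almost everywhere it is a combination of
    -- the other three integrable pairings.
    have h4 : Integrable (fun τ => (∫ x, TorusPDE.absPow p (u τ) x ∂torusMeasure N)
        * ∫ x, φ τ x ∂torusMeasure N) (volume.restrict (Ioc 0 T)) := by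
      refine ((h1.sub h2).sub h3).congr ?_
      filter_upwards [hae] with τ hτ
      simp only [Pi.sub_apply]
      rw [hτ]; ring
    have h12 : Integrable (fun τ => (∫ x, TorusPDE.absPow p (u τ) x * φ τ x ∂torusMeasure N)
        - ∫ x, φ τ x * TorusPDE.advect (v τ) (u τ) x ∂torusMeasure N)
        (volume.restrict (Ioc 0 T)) := h1.sub h2
    have h5 : ∫ t in 0..T, ∫ x, TorusPDE.forcing p v u t x * φ t x ∂torusMeasure N
        = (∫ t in 0..T, ∫ x, TorusPDE.absPow p (u t) x * φ t x ∂torusMeasure N)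
        - (∫ t in 0..T, ∫ x, φ t x * TorusPDE.advect (v t) (u t) x ∂torusMeasure N)
        - ∫ t in 0..T, (∫ x, TorusPDE.absPow p (u t) x ∂torusMeasure N)
          * ∫ x, φ t x ∂torusMeasure N := by
      simp only [intervalIntegral.integral_of_le hT.le]
      rw [integral_congr_ae hae, integral_sub h12 h4]
      congr 1
      exact integral_sub h1 h2
    rw [h5]; ring

/-- The mean of the solution vanishes at all times. -/
theorem IsRegularSolution.integral_eq_zero (h : IsRegularSolution p T v u)
    (hv : IsBoundedFlow v) (hdiv : IsIncompressible v) (h0 : ∫ x, u 0 x ∂torusMeasure N = 0)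
    {t : ℝ} (ht : t ∈ Icc 0 T) : ∫ x, u t x ∂torusMeasure N = 0 := by
  obtain ⟨V, hV⟩ := hv.exists_bound
  have hle : volume.restrict (Ioc 0 t) ≤ volume.restrict (Ioc 0 T) :=
    Measure.restrict_mono (Ioc_subset_Ioc_right ht.2) le_rfl
  have hle' : volume.restrict (Ioc 0 t) ≤ volume.restrict (Ioi 0) :=
    Measure.restrict_mono Ioc_subset_Ioi_self le_rfl
  have key := h.flow.ode 0 t ht
  -- The zero mode of the right-hand side vanishes: the eigenvalue is zero, advection has mean zero
  -- by incompressibility, and the mean of `|u|^p` is subtracted.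
  have hz : ∫ τ in (0 : ℝ)..t, ((-eig (0 : Fin N → ℤ) : ℂ) * torusCoeff (u τ) 0
      + torusCoeff (TorusPDE.forcing p v u τ) 0) = 0 := by
    rw [intervalIntegral.integral_of_le ht.1]
    refine integral_eq_zero_of_ae ?_
    filter_upwards [ae_mono hle h.absPow.memLp, ae_mono hle h.advect.memLp, ae_mono hle' hV,
      ae_mono hle' hdiv, ae_restrict_mem measurableSet_Ioc] with τ hB hA hVτ hd hτ
    have hA0 : ∫ x, TorusPDE.advect (v τ) (u τ) x ∂torusMeasure N = 0 :=
      hd.integral_inner_eq_zero hVτ.1 hVτ.2 (memLp_coe (u τ)) (Lp.memLp _)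
        (weakGrad_spec (h.flow.hasL2Grad τ ⟨hτ.1, hτ.2.trans ht.2⟩))
    rw [torusCoeff_forcing hB hA, torusCoeff_zero (TorusPDE.advect (v τ) (u τ)), hA0,
      torusCoeff_zero (TorusPDE.absPow p (u τ)), eig_zero]
    simp
  rw [hz, add_zero, torusCoeff_zero, torusCoeff_zero, h0] at key
  exact_mod_cast key

/-- In the pairing of the forcing with `u`, advection drops out by incompressibility and the mean
term because `u` keeps zero mean, leaving `∫ |u|^p u`. -/
theorem IsRegularSolution.energy (h : IsRegularSolution p T v u)
    (hv : IsBoundedFlow v) (hdiv : IsIncompressible v) (h0 : ∫ x, u 0 x ∂torusMeasure N = 0)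
    {t : ℝ} (ht : t ∈ Icc 0 T) :
    ‖u 0‖ ^ 2 + 2 * ∫ τ in 0..t, ∫ x, |u τ x| ^ p * u τ x ∂torusMeasure N =
      ‖u t‖ ^ 2 + 2 * ∫ τ in 0..t, ∫ x, ‖weakGrad (u τ) x‖ ^ 2 ∂torusMeasure N := by
  obtain ⟨V, hV⟩ := hv.exists_bound
  have hle : volume.restrict (Ioc 0 t) ≤ volume.restrict (Ioc 0 T) :=
    Measure.restrict_mono (Ioc_subset_Ioc_right ht.2) le_rfl
  have hle' : volume.restrict (Ioc 0 t) ≤ volume.restrict (Ioi 0) :=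
    Measure.restrict_mono Ioc_subset_Ioi_self le_rfl
  have he := h.flow.energy le_rfl ht.1 ht.2 (h.forcing.mono_measure hle)
    fun i => (h.grad i).mono_measure hle
  have hF : ∫ τ in 0..t, ∫ x, TorusPDE.forcing p v u τ x * u τ x ∂torusMeasure N
      = ∫ τ in 0..t, ∫ x, |u τ x| ^ p * u τ x ∂torusMeasure N := by
    rw [intervalIntegral.integral_of_le ht.1, intervalIntegral.integral_of_le ht.1]
    refine integral_congr_ae ?_
    filter_upwards [ae_mono hle h.absPow.memLp, ae_mono hle h.advect.memLp, ae_mono hle' hV,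
      ae_mono hle' hdiv, ae_restrict_mem measurableSet_Ioc] with τ hB hA hVτ hd hτ
    have hA0 : ∫ x, u τ x * TorusPDE.advect (v τ) (u τ) x ∂torusMeasure N = 0 :=
      hd.integral_mul_inner_eq_zero hVτ.1 hVτ.2 (memLp_coe (u τ)) (Lp.memLp _)
        (weakGrad_spec (h.flow.hasL2Grad τ ⟨hτ.1, hτ.2.trans ht.2⟩))
    rw [integral_forcing_mul hB hA (memLp_coe (u τ)), hA0,
      h.integral_eq_zero hv hdiv h0 ⟨hτ.1.le, hτ.2.trans ht.2⟩, mul_zero, sub_zero, sub_zero]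
    rfl
  rw [hF] at he
  linarith

end TorusPDE

end

open TorusPDE
theorem mainTheorem5 (N : ℕ) (hN : 1 ≤ N) (p : ℝ) (hp1 : 1 ≤ p) (hp2 : p < 1 + 2 / (N : ℝ))
    (v : ℝ → Torus N → EuclideanSpace ℝ (Fin N))
    (hv : IsBoundedFlow v) (hdiv : IsIncompressible v)
    (u₀ : L2 N) (hmean : ∫ x, u₀ x ∂torusMeasure N = 0)
    (T : ℝ) (hT : 0 < T) (u : ℝ → L2 N)
    (huX : MemX T u) (hu : IsMildSolution p v u₀ T u) :
    IsWeakSolution p v u₀ T u ∧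
    ∀ t ∈ Ico 0 T,
      (∀ᵐ τ ∂volume.restrict (Ioc 0 t),
        Integrable (fun x => |u τ x| ^ p * u τ x) (torusMeasure N)) ∧
      IntervalIntegrable (fun τ => ∫ x, |(|u τ x| ^ p * u τ x)| ∂torusMeasure N) volume 0 t ∧
      IntervalIntegrable (fun τ => ∫ x, ‖weakGrad (u τ) x‖ ^ 2 ∂torusMeasure N) volume 0 t ∧
      ‖u₀‖ ^ 2 + 2 * ∫ τ in 0..t, ∫ x, |u τ x| ^ p * u τ x ∂torusMeasure N =
        ‖u t‖ ^ 2 + 2 * ∫ τ in 0..t, ∫ x, ‖weakGrad (u τ) x‖ ^ 2 ∂torusMeasure N := by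
  have h := hu.isRegularSolution hN hp1 hp2 hv hT huX
  have hu0 := hu.eq_zero_time hT.le
  refine ⟨h.isWeakSolution hT hu, fun t ht => ?_⟩
  have hle : volume.restrict (Ioc 0 t) ≤ volume.restrict (Ioc 0 T) :=
    Measure.restrict_mono (Ioc_subset_Ioc_right ht.2.le) le_rfl
  have hB := h.absPow.mono_measure hle
  refine ⟨?_, ?_, ?_, ?_⟩
  · filter_upwards [hB.memLp] with τ hτ
    exact hτ.integrable_mul (memLp_coe (u τ))
  · rw [intervalIntegrable_iff_integrableOn_Ioc_of_le ht.1]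
    have hi := hB.integrable_integral_mul
      (sqIntegrable_abs (hu.1.mono (Icc_subset_Icc_right ht.2.le)))
    refine hi.congr (Filter.Eventually.of_forall fun τ => ?_)
    refine integral_congr_ae (Filter.Eventually.of_forall fun x => ?_)
    simp only [absPow]
    rw [abs_mul, abs_of_nonneg (Real.rpow_nonneg (abs_nonneg _) p)]
  · rw [intervalIntegrable_iff_integrableOn_Ioc_of_le ht.1]
    exact IsHeatFlow.integrable_sq_norm_grad fun i => (h.grad i).mono_measure hle
  · rw [← hu0]
    exact h.energy hv hdiv (by rw [hu0]; exact hmean) ⟨ht.1, ht.2.le⟩
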